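/- **Calculus.** Messages are built from variables, located aliases $s\lambda$ ($s\in\{0,1\}^*$, $\lambda$ an alias variable) and the function symbols $\langle\cdot,\cdot\rangle$, $\mathsf{fst}$, $\mathsf{snd}$, $\mathsf{enc}$, $\mathsf{dec}$, $\mathsf{mac}$; $=_E$ is the least congruence on messages with $\mathsf{fst}\langle M,N\rangle=_E M$, $\mathsf{snd}\langle M,N\rangle=_E N$, $\mathsf{dec}(\mathsf{enc}(M,K),K)=_E M$ ($\mathsf{mac}$ is free). Processes of the applied $\pi$-calculus are $0$, $\nu x.P$, $P\mid Q$, $M(x).P$, $\overline{M}\langle N\rangle.P$, $[M=N]P$, guarded choice $G+H$, and $!P$; extended processes are $\nu\vec x.(\sigma\mid P)$ with $\sigma$ an active substitution from aliases to messages (with domain $\mathrm{dom}$); everything is taken up to $\alpha$-conversion of variables. Transitions $A\xrightarrow{\pi}_{u}A'$, with early labels $\pi$ (input $M\,N$, output $\overline M(\alpha)$ of a message recorded in the active substitution under a fresh located alias $\alpha$, or $\tau$) and location labels $u$, are those of the located (non-interleaving) early structural operational semantics of the applied $\pi$-calculus; the messages in labels of extended processes contain no restricted variables, refer only to aliases in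 the domain of the active substitution, and channels are compared modulo $=_E$. $\nu\vec x.(\sigma\mid P)\models M=N$ means $M\sigma=_E N\sigma$, where $\vec x$ do not occur in $M,N$. An *i-simulation* is a family of relations $\mathcal R^\rho$ such that $A\mathrel{\mathcal R^\rho}B$ implies: $\rho:\mathrm{dom}(A)\to\mathrm{dom}(B)$ is a bijection; if $A\xrightarrow{\pi}_uA'$ with $\pi$ not an output, then $B\xrightarrow{\pi\rho}_{u'}B'$ with $A'\mathrel{\mathcal R^\rho}B'$ for some $u',B'$; if $A\xrightarrow{\overline M(\alpha)}_uA'$, then $B\xrightarrow{\overline{M\rho}(\alpha')}_{u'}B'$ with $A'\mathrel{\mathcal R^{\rho[\alpha\mapsto\alpha']}}B'$ for some $u',\alpha',B'$; and $A\models M=N$ iff $B\models M\rho=N\rho$ for all messages $M,N$ whose aliases are in $\mathrm{dom}(A)$. $A$ is *i-simulated* by $B$ if $A\mathrel{\mathcal R^{\mathrm{id}}}B$ for some i-simulation $\mathcal R$; a process $P$ is identified with $\mathrm{id}\mid P$. *FM formulas* are $\phi::=\mathtt{true}\mid M=N\mid\phi\wedge\phi\mid\neg\phi\mid\langle\pi\rangle\phi$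 with $\pi$ of the form $\tau$, $M\,N$ or $\overline M(x)$ (which binds $x$); $A\models\langle\overline M(x)\rangle\phi$ iff $A\xrightarrow{\overline M(\alpha)}_uB$ and $B\models\phi\{\alpha/x\}$ for some $u$, $B$ and some $\alpha$ not occurring in $\phi$; $A\models\langle\pi\rangle\phi$ for other $\pi$ iff $A\xrightarrow{\pi}_uB$ and $B\models\phi$ for some $u,B$; the other connectives are classical. The *simulation fragment* consists of the formulas in which negation is applied to equalities only. **BAC protocol.** With $M_V=\mathsf{enc}(\langle nr,\langle nt,kr\rangle\rangle,ke)$ and $M_P=\mathsf{enc}(\langle nt,\langle\mathsf{fst}(\mathsf{dec}(\mathsf{fst}(y),ke)),kt\rangle\rangle,ke)$, let $$V(c,d,ke,km)=d(nt).\nu nr.\nu kr.\overline c\langle\langle M_V,\mathsf{mac}(M_V,km)\rangle\rangle,$$ $$P(c,d,ke,km)=\nu nt.\overline c\langle nt\rangle.d(y).[\mathsf{snd}(y)=\mathsf{mac}(\mathsf{fst}(y),km)][nt=\mathsf{fst}(\mathsf{snd}(\mathsf{dec}(\mathsf{fst}(y),ke)))]\nu kt.\overline c\langle\langle M_P,\mathsf{mac}(M_P,km)\rangle\rangle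 .$$ **Theorem.** Let $r\neq p$ be two free channel variables and $$\mathit{System}_{ch}={!}\nu ke,km.{!}\big(\nu c.\overline r\langle c\rangle.V(c,c,ke,km)\mid\nu c.\overline p\langle c\rangle.P(c,c,ke,km)\big),$$ $$\mathit{Spec}_{ch}={!}\nu ke,km.\big(\nu c.\overline r\langle c\rangle.V(c,c,ke,km)\mid\nu c.\overline p\langle c\rangle.P(c,c,ke,km)\big).$$ Then $\mathit{System}_{ch}$ is not i-simulated by $\mathit{Spec}_{ch}$. Moreover the formula $$\phi=\langle\overline p(p_1)\rangle\langle\overline r(r_1)\rangle\langle\overline r(r_2)\rangle\langle\overline{p_1}(nt_1)\rangle\langle r_1\,nt_1\rangle\langle r_2\,nt_1\rangle\langle\overline{r_1}(u_1)\rangle\langle\overline{r_2}(u_2)\rangle\big(\langle p_1\,u_1\rangle\langle\overline{p_1}(w)\rangle\mathtt{true}\wedge\langle p_1\,u_2\rangle\langle\overline{p_1}(w)\rangle\mathtt{true}\big)$$ is in the simulation fragment, $\mathit{System}_{ch}\models\phi$ and $\mathit{Spec}_{ch}\not\models\phi$. -/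

import Mathlib

namespace BAC

/-! ## Messages

Binders are represented by de Bruijn indices, so that terms are identified exactly when they are
α-convertible.  Below `d` binders, `var i` with `i < d` refers to the `i`-th enclosing binder
(counted from the innermost one), and `var (k + d)` is the free variable number `k`. -/

/-- A located alias `sλ`: a location prefix `s ∈ {0,1}*` and an alias variable `λ`
(`false` is `0`, `true` is `1`). -/
abbrev Alias := List Bool × ℕ

/-- Messages over the signature of pairs, symmetric encryption and message authentication codes. -/
inductive Msg : Type
  | var (i : ℕ)
  | ali (a : Alias)
  | pair (M N : Msg)
  | fst (M : Msg)
  | snd (M : Msg)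
  | enc (M K : Msg)
  | dec (M K : Msg)
  | mac (M K : Msg)

namespace Msg

/-- Simultaneous substitution of messages for variables. -/
def subst (τ : ℕ → Msg) : Msg → Msg
  | var i => τ i
  | ali a => ali a
  | pair M N => pair (M.subst τ) (N.subst τ)
  | fst M => fst (M.subst τ)
  | snd M => snd (M.subst τ)
  | enc M K => enc (M.subst τ) (K.subst τ)
  | dec M K => dec (M.subst τ) (K.subst τ)
  | mac M K => mac (M.subst τ) (K.subst τ)

/-- Application `Mσ` of a substitution on located aliases. -/
def aliasSubst (σ : Alias → Msg) : Msg → Msg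
  | var i => var i
  | ali a => σ a
  | pair M N => pair (M.aliasSubst σ) (N.aliasSubst σ)
  | fst M => fst (M.aliasSubst σ)
  | snd M => snd (M.aliasSubst σ)
  | enc M K => enc (M.aliasSubst σ) (K.aliasSubst σ)
  | dec M K => dec (M.aliasSubst σ) (K.aliasSubst σ)
  | mac M K => mac (M.aliasSubst σ) (K.aliasSubst σ)

/-- Free aliases of a message. -/
def fal : Msg → Set Alias
  | var _ => ∅
  | ali a => {a}
  | pair M N => M.fal ∪ N.fal
  | fst M => M.fal
  | snd M => M.fal
  | enc M K => M.fal ∪ K.fal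
  | dec M K => M.fal ∪ K.fal
  | mac M K => M.fal ∪ K.fal

/-- The same message, placed below `n` further binders that do not occur in it. -/
def shift (n : ℕ) (M : Msg) : Msg := M.subst fun i => var (i + n)

/-- A substitution for variables, carried below one binder. -/
def lift (τ : ℕ → Msg) : ℕ → Msg
  | 0 => var 0
  | i + 1 => (τ i).shift 1

/-- The substitution that removes the innermost binder and replaces its variable by `N`. -/
def inst (N : Msg) : ℕ → Msg
  | 0 => N
  | i + 1 => var i

/-- Renaming `Mρ` of the aliases of a message. -/
def renameAlias (ρ : Alias → Alias) (M : Msg) : Msg := M.aliasSubst fun a => ali (ρ a)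

/-- The equational theory: the least congruence with `fst⟨M,N⟩ = M`, `snd⟨M,N⟩ = N` and
`dec(enc(M,K),K) = M`. -/
inductive EqE : Msg → Msg → Prop
  | refl (M : Msg) : EqE M M
  | symm {M N : Msg} : EqE M N → EqE N M
  | trans {M N K : Msg} : EqE M N → EqE N K → EqE M K
  | pair {M M' N N' : Msg} : EqE M M' → EqE N N' → EqE (.pair M N) (.pair M' N')
  | fst {M M' : Msg} : EqE M M' → EqE (.fst M) (.fst M')
  | snd {M M' : Msg} : EqE M M' → EqE (.snd M) (.snd M')
  | enc {M M' K K' : Msg} : EqE M M' → EqE K K' → EqE (.enc M K) (.enc M' K')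
  | dec {M M' K K' : Msg} : EqE M M' → EqE K K' → EqE (.dec M K) (.dec M' K')
  | mac {M M' K K' : Msg} : EqE M M' → EqE K K' → EqE (.mac M K) (.mac M' K')
  | fst_pair (M N : Msg) : EqE (.fst (.pair M N)) M
  | snd_pair (M N : Msg) : EqE (.snd (.pair M N)) N
  | dec_enc (M K : Msg) : EqE (.dec (.enc M K) K) M

end Msg

/-! ## Processes and extended processes -/

/-- Processes.  `nu` and `inp` bind the variable of index `0` in their continuation.  In the
calculus `choice` is only applied to guarded processes; no other use of it is ever reached from
a process that obeys this. -/
inductive Proc : Type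
  | nil
  | nu (P : Proc)
  | par (P Q : Proc)
  | inp (K : Msg) (P : Proc)
  | out (K N : Msg) (P : Proc)
  | cond (M N : Msg) (P : Proc)
  | choice (G H : Proc)
  | bang (P : Proc)

namespace Proc

/-- Capture-avoiding substitution of messages for variables. -/
def subst : (ℕ → Msg) → Proc → Proc
  | _, nil => nil
  | τ, nu P => nu (P.subst (Msg.lift τ))
  | τ, par P Q => par (P.subst τ) (Q.subst τ)
  | τ, inp K P => inp (K.subst τ) (P.subst (Msg.lift τ))
  | τ, out K N P => out (K.subst τ) (N.subst τ) (P.subst τ)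
  | τ, cond M N P => cond (M.subst τ) (N.subst τ) (P.subst τ)
  | τ, choice G H => choice (G.subst τ) (H.subst τ)
  | τ, bang P => bang (P.subst τ)

/-- The same process, placed below `n` further binders that do not occur in it. -/
def shift (n : ℕ) (P : Proc) : Proc := P.subst fun i => .var (i + n)

end Proc

/-- The extended process `νx₁…νxₙ.(σ | P)`: the `n` restricted variables are the indices
`0, …, n - 1` in the messages `σ α` and in `P`.  The active substitution `σ` is a function on
located aliases, which maps an alias outside its domain to itself. -/
structure ExtProc : Type where
  n : ℕ
  σ : Alias → Msg
  P : Proc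

/-- The domain of a substitution on located aliases. -/
def domSubst (σ : Alias → Msg) : Set Alias := {a | σ a ≠ Msg.ali a}

/-- The domain of (the active substitution of) an extended process. -/
def ExtProc.dom (A : ExtProc) : Set Alias := domSubst A.σ

/-- The extended process `id | P`. -/
def ExtProc.ofProc (P : Proc) : ExtProc := ⟨0, Msg.ali, P⟩

/-! ## Labels -/

/-- Early action labels: free input `M N`, output `M̄(α)`, interaction `τ`. -/
inductive Label : Type
  | inp (M N : Msg)
  | out (M : Msg) (a : Alias)
  | tau

/-- The same label, placed below `n` further binders that do not occur in it. -/
def Label.shift (n : ℕ) : Label → Label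
  | .inp M N => .inp (M.shift n) (N.shift n)
  | .out M a => .out (M.shift n) a
  | .tau => .tau

/-- A location `s[t]`. -/
abbrev Loc := List Bool × List Bool

/-- Location labels: a location or a pair of locations. -/
inductive LocLabel : Type
  | single (l : Loc)
  | two (l₀ l₁ : Loc)

/-- The location `cℓ`. -/
def Loc.pre (c : Bool) (l : Loc) : Loc := (c :: l.1, l.2)

/-- The location label `cu`. -/
def LocLabel.pre (c : Bool) : LocLabel → LocLabel
  | .single l => .single (Loc.pre c l)
  | .two l₀ l₁ => .two (Loc.pre c l₀) (Loc.pre c l₁)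

/-! ## Structural operational semantics -/

/-- The renaming that exchanges the `m` innermost binders with the `k` binders around them. -/
def swapBlocks (m k i : ℕ) : ℕ := if i < m then i + k else if i < m + k then i - m else i

/-- The renaming that inserts `m` binders around the `k` innermost ones. -/
def insertBelow (m k i : ℕ) : ℕ := if i < k then i else i + m

/-- Transitions `P —π→ᵤ νx⃗.(σ | R)` of processes.  The side conditions on freshness of bound
variables are expressed by `shift`: what is shifted below a binder does not mention its variable. -/
inductive Trans : Proc → Label → LocLabel → ExtProc → Prop
  | inp {M K : Msg} (N : Msg) (P : Proc) : Msg.EqE M K →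
      Trans (.inp K P) (.inp M N) (.single ([], [])) ⟨0, Msg.ali, P.subst (Msg.inst N)⟩
  | out {M K : Msg} (N : Msg) (P : Proc) (l : ℕ) : Msg.EqE M K →
      Trans (.out K N P) (.out M ([], l)) (.single ([], []))
        ⟨0, Function.update Msg.ali ([], l) N, P⟩
  | parL {P Q R : Proc} {π : Label} {u : LocLabel} {m : ℕ} {σ : Alias → Msg} :
      Trans P π u ⟨m, σ, R⟩ →
      Trans (.par P Q) π (u.pre false) ⟨m, σ, .par R (Q.shift m)⟩
  | parR {P Q R : Proc} {π : Label} {u : LocLabel} {m : ℕ} {σ : Alias → Msg} :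
      Trans Q π u ⟨m, σ, R⟩ →
      Trans (.par P Q) π (u.pre true) ⟨m, σ, .par (P.shift m) R⟩
  | ext {P R : Proc} {π : Label} {u : LocLabel} {m : ℕ} {σ : Alias → Msg} :
      Trans P (π.shift 1) u ⟨m, σ, R⟩ →
      Trans (.nu P) π u ⟨m + 1, σ, R⟩
  | sumL {G H : Proc} {π : Label} {t : List Bool} {A : ExtProc} :
      Trans G π (.single ([], t)) A →
      Trans (.choice G H) π (.single ([], false :: t)) A
  | sumR {G H : Proc} {π : Label} {t : List Bool} {A : ExtProc} :
      Trans H π (.single ([], t)) A →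
      Trans (.choice G H) π (.single ([], true :: t)) A
  | mat {G : Proc} {M N : Msg} {π : Label} {u : LocLabel} {A : ExtProc} :
      Trans G π u A → Msg.EqE M N →
      Trans (.cond M N G) π u A
  | bang {P : Proc} {π : Label} {u : LocLabel} {A : ExtProc} :
      Trans (.par P (.bang P)) π u A →
      Trans (.bang P) π u A
  /-- The sender's restricted variables `y⃗` (`m` of them) become binders around the receiver,
  whose own restricted variables `w⃗` (`k` of them) stay inside: the target is
  `νy⃗,w⃗.(id | P' | Q')`. -/
  | closeL {P Q P' Q' : Proc} {M N : Msg} {a l₀ l₁ m k} :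
      Trans P (.out M ([], a)) (.single l₀)
        ⟨m, Function.update Msg.ali ([], a) N, P'⟩ →
      Trans (Q.shift m) (.inp (M.shift m) N) (.single l₁) ⟨k, Msg.ali, Q'⟩ →
      Trans (.par P Q) .tau (.two (Loc.pre false l₀) (Loc.pre true l₁))
        ⟨m + k, Msg.ali, .par (P'.shift k) Q'⟩
  /-- As `closeL`, with the sender (restricted variables `w⃗`, `k` of them) on the right and the
  receiver (restricted variables `y⃗`, `m` of them) on the left; the target is again
  `νy⃗,w⃗.(id | P' | Q')`, with `y⃗` outermost. -/
  | closeR {P Q P' Q' : Proc} {M N : Msg} {a l₀ l₁ m k} :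
      Trans (P.shift k) (.inp (M.shift k) N) (.single l₀) ⟨m, Msg.ali, P'⟩ →
      Trans Q (.out M ([], a)) (.single l₁)
        ⟨k, Function.update Msg.ali ([], a) N, Q'⟩ →
      Trans (.par P Q) .tau (.two (Loc.pre true l₁) (Loc.pre false l₀))
        ⟨m + k, Msg.ali, .par (P'.subst fun i => .var (swapBlocks m k i))
          (Q'.subst fun i => .var (insertBelow m k i))⟩

/-- Transitions `A —π→ᵤ B` of extended processes `A = νx₁…νxₙ.(σ | P)`: one of the two alias
rules applied to `σ | P` (the second one split into inputs and interactions), followed by the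
restriction rule for each of `x₁, …, xₙ`.  Active substitutions have no aliases in their range,
so that the composition of `σ` with `{N/sλ}` is the update of `σ` at `sλ`. -/
inductive ETrans : ExtProc → Label → LocLabel → ExtProc → Prop
  | aliasOut {n m : ℕ} {σ : Alias → Msg} {P Q : Proc} {M N : Msg} {s t : List Bool} {l : ℕ} :
      Trans P (.out ((M.shift n).aliasSubst σ) ([], l)) (.single (s, t))
        ⟨m, Function.update Msg.ali ([], l) N, Q⟩ →
      M.fal ⊆ domSubst σ → (s, l) ∉ domSubst σ →
      ETrans ⟨n, σ, P⟩ (.out M (s, l)) (.single (s, t))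
        ⟨n + m, Function.update (fun a => (σ a).shift m) (s, l) N, Q⟩
  | aliasInp {n m : ℕ} {σ : Alias → Msg} {P Q : Proc} {M N : Msg} {u : LocLabel} :
      Trans P (.inp ((M.shift n).aliasSubst σ) ((N.shift n).aliasSubst σ)) u
        ⟨m, Msg.ali, Q⟩ →
      M.fal ⊆ domSubst σ → N.fal ⊆ domSubst σ →
      ETrans ⟨n, σ, P⟩ (.inp M N) u ⟨n + m, fun a => (σ a).shift m, Q⟩
  | aliasTau {n m : ℕ} {σ : Alias → Msg} {P Q : Proc} {u : LocLabel} :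
      Trans P .tau u ⟨m, Msg.ali, Q⟩ →
      ETrans ⟨n, σ, P⟩ .tau u ⟨n + m, fun a => (σ a).shift m, Q⟩

/-! ## Interleaving similarity -/

/-- Satisfaction `A ⊨ M = N` of an equality of messages. -/
def SatEq (A : ExtProc) (M N : Msg) : Prop :=
  Msg.EqE ((M.shift A.n).aliasSubst A.σ) ((N.shift A.n).aliasSubst A.σ)

/-- Interleaving simulations: families `R ρ` of relations on extended processes, where
`ρ` restricts to a bijection from `dom A` to `dom B` whenever `R ρ A B`. -/
structure IsISimulation (R : (Alias → Alias) → ExtProc → ExtProc → Prop) : Prop where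
  bij : ∀ {ρ A B}, R ρ A B → Set.BijOn ρ A.dom B.dom
  inp : ∀ {ρ A B M N u A'}, R ρ A B → ETrans A (.inp M N) u A' →
    ∃ u' B', ETrans B (.inp (M.renameAlias ρ) (N.renameAlias ρ)) u' B' ∧ R ρ A' B'
  tau : ∀ {ρ A B u A'}, R ρ A B → ETrans A .tau u A' →
    ∃ u' B', ETrans B .tau u' B' ∧ R ρ A' B'
  out : ∀ {ρ A B M a u A'}, R ρ A B → ETrans A (.out M a) u A' →
    ∃ u' a' B', ETrans B (.out (M.renameAlias ρ) a') u' B' ∧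
      R (Function.update ρ a a') A' B'
  static : ∀ {ρ A B M N}, R ρ A B → M.fal ⊆ A.dom → N.fal ⊆ A.dom →
    (SatEq A M N ↔ SatEq B (M.renameAlias ρ) (N.renameAlias ρ))

/-- `A` is i-simulated by `B`. -/
def ISimulated (A B : ExtProc) : Prop := ∃ R, IsISimulation R ∧ R id A B

/-! ## The modal logic FM -/

/-- Formulas.  `diaOut M φ` is `⟨M̄(x)⟩φ`; it binds the variable of index `0` in `φ`. -/
inductive Formula : Type
  | top
  | eq (M N : Msg)
  | conj (φ ψ : Formula)
  | neg (φ : Formula)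
  | diaTau (φ : Formula)
  | diaInp (M N : Msg) (φ : Formula)
  | diaOut (M : Msg) (φ : Formula)

namespace Formula

/-- Capture-avoiding substitution of messages for variables. -/
def subst : (ℕ → Msg) → Formula → Formula
  | _, top => top
  | τ, eq M N => eq (M.subst τ) (N.subst τ)
  | τ, conj φ ψ => conj (φ.subst τ) (ψ.subst τ)
  | τ, neg φ => neg (φ.subst τ)
  | τ, diaTau φ => diaTau (φ.subst τ)
  | τ, diaInp M N φ => diaInp (M.subst τ) (N.subst τ) (φ.subst τ)
  | τ, diaOut M φ => diaOut (M.subst τ) (φ.subst (Msg.lift τ))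

/-- Free aliases of a formula. -/
def fal : Formula → Set Alias
  | top => ∅
  | eq M N => M.fal ∪ N.fal
  | conj φ ψ => φ.fal ∪ ψ.fal
  | neg φ => φ.fal
  | diaTau φ => φ.fal
  | diaInp M N φ => M.fal ∪ N.fal ∪ φ.fal
  | diaOut M φ => M.fal ∪ φ.fal

/-- The simulation fragment: negation is applied to equalities only. -/
def InSimulationFragment : Formula → Prop
  | top => True
  | eq _ _ => True
  | conj φ ψ => φ.InSimulationFragment ∧ ψ.InSimulationFragment
  | neg (eq _ _) => True
  | neg _ => False
  | diaTau φ => φ.InSimulationFragment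
  | diaInp _ _ φ => φ.InSimulationFragment
  | diaOut _ φ => φ.InSimulationFragment

/-- Number of connectives. -/
def size : Formula → ℕ
  | top => 0
  | eq _ _ => 0
  | conj φ ψ => φ.size + ψ.size + 1
  | neg φ => φ.size + 1
  | diaTau φ => φ.size + 1
  | diaInp _ _ φ => φ.size + 1
  | diaOut _ φ => φ.size + 1

theorem size_subst (φ : Formula) : ∀ τ : ℕ → Msg, (φ.subst τ).size = φ.size := by
  induction φ <;> intro τ <;> simp_all [subst, size]

end Formula

/-- Satisfaction `A ⊨ φ`. -/
def Sat (A : ExtProc) : Formula → Prop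
  | .top => True
  | .eq M N => SatEq A M N
  | .conj φ ψ => Sat A φ ∧ Sat A ψ
  | .neg φ => ¬ Sat A φ
  | .diaTau φ => ∃ u B, ETrans A .tau u B ∧ Sat B φ
  | .diaInp M N φ => ∃ u B, ETrans A (.inp M N) u B ∧ Sat B φ
  | .diaOut M φ => ∃ u a B, ETrans A (.out M a) u B ∧ a ∉ φ.fal ∧
      Sat B (φ.subst (Msg.inst (.ali a)))
termination_by φ => φ.size
decreasing_by all_goals (simp only [Formula.size, Formula.size_subst]; omega)

/-! ## The BAC protocol with fresh endpoint channels -/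

open Msg Proc

/-- The prover
`P(c,d,ke,km) = νnt. c̄⟨nt⟩. d(y). [snd y = mac(fst y, km)] [nt = fst(snd(dec(fst y, ke)))]
νkt. let m = enc(⟨nt, ⟨fst(dec(fst y, ke)), kt⟩⟩, ke) in c̄⟨⟨m, mac(m, km)⟩⟩`.
The indices of `nt`, `y`, `kt` are `0, -, -`, then `1, 0, -`, then `2, 1, 0`. -/
def Prover (c d ke km : Msg) : Proc :=
  nu <| out (c.shift 1) (var 0) <|
    inp (d.shift 1) <|
      cond (snd (var 0)) (mac (fst (var 0)) (km.shift 2)) <|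
      cond (var 1) (fst (snd (dec (fst (var 0)) (ke.shift 2)))) <|
        nu <|
          let m := enc (pair (var 2) (pair (fst (dec (fst (var 1)) (ke.shift 3))) (var 0)))
            (ke.shift 3)
          out (c.shift 3) (pair m (mac m (km.shift 3))) nil

/-- The verifier `V(c,d,ke,km) =
d(nt). νnr. νkr. let m = enc(⟨nr, ⟨nt, kr⟩⟩, ke) in c̄⟨⟨m, mac(m, km)⟩⟩`.
At the output the indices of `nt`, `nr`, `kr` are `2, 1, 0`. -/
def Verifier (c d ke km : Msg) : Proc :=
  inp d <| nu <| nu <|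
    let m := enc (pair (var 1) (pair (var 2) (var 0))) (ke.shift 3)
    out (c.shift 3) (pair m (mac m (km.shift 3))) nil

/-- One session below the binders `νke, km`:
`νc. r̄⟨c⟩. V(c,c,ke,km) | νc. p̄⟨c⟩. P(c,c,ke,km)`.
Below `νke, km, c` the indices of `ke`, `km`, `c` are `2, 1, 0`. -/
def Session (r p : ℕ) : Proc :=
  par
    (nu <| out (var (r + 3)) (var 0) <| Verifier (var 0) (var 0) (var 2) (var 1))
    (nu <| out (var (p + 3)) (var 0) <| Prover (var 0) (var 0) (var 2) (var 1))

/-- `!νke,km.!(νc.r̄⟨c⟩.V(c,c,ke,km) | νc.p̄⟨c⟩.P(c,c,ke,km))`. -/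
def SystemCh (r p : ℕ) : Proc := bang <| nu <| nu <| bang <| Session r p

/-- `!νke,km.(νc.r̄⟨c⟩.V(c,c,ke,km) | νc.p̄⟨c⟩.P(c,c,ke,km))`. -/
def SpecCh (r p : ℕ) : Proc := bang <| nu <| nu <| Session r p

/-- The attack formula
`⟨p̄(p₁)⟩⟨r̄(r₁)⟩⟨r̄(r₂)⟩⟨p̄₁(nt₁)⟩⟨r₁ nt₁⟩⟨r₂ nt₁⟩⟨r̄₁(u₁)⟩⟨r̄₂(u₂)⟩
(⟨p₁ u₁⟩⟨p̄₁(w)⟩true ∧ ⟨p₁ u₂⟩⟨p̄₁(w)⟩true)`.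
The bound variables are, from the outside, `p₁, r₁, r₂, nt₁, u₁, u₂`; at the conjunction their
indices are `5, 4, 3, 2, 1, 0`. -/
def attackFormula (r p : ℕ) : Formula :=
  .diaOut (var p) <|
  .diaOut (var (r + 1)) <|
  .diaOut (var (r + 2)) <|
  .diaOut (var 2) <|
  .diaInp (var 2) (var 0) <|
  .diaInp (var 1) (var 0) <|
  .diaOut (var 2) <|
  .diaOut (var 2) <|
  .conj
    (.diaInp (var 5) (var 1) <| .diaOut (var 5) .top)
    (.diaInp (var 5) (var 0) <| .diaOut (var 5) .top)

end BAC

/-! In the specification each pair of keys `ke`, `km` serves one verifier and one prover, whereas in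
the system the inner replication gives a pair of keys to several sessions. The formula relays one
prover's challenge to two verifiers and asks that either reply be acceptable to that prover. In the
system the two verifiers are taken from two sessions under the same keys, so both replies pass both
tests. In the specification acceptance forces the key of the MAC in the reply to be the prover's own
`km`, because `mac` is free (`Inv.key_eq`); two different verifiers have different keys, so at most
one of the replies can be accepted.

The negative half needs control over all runs of the specification. No modality of the formula is
`τ`, so each transition is performed by a single parallel component (`Trans.exists_component`,
`Trans.of_bang`), and a process is described by the multiset of its components, coded by `Leaf`. The
relations `OutStep` and `InpStep` over-approximate the steps of a component. The invariant `Inv`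
says that private channels and the keys of verifiers are not shared. Hence an action on a recorded
private channel identifies its performer, and following the formula modality by modality
(`not_posSat_SpecCh`) leads to two verifiers with the same key.

Non-similarity follows from the same refutation, since simulations preserve formulas without
negation. The alias with which the simulating process answers an output is not known to be fresh for
the renamed formula, so preservation is proved for the weaker satisfaction `PosSat` without the
freshness condition. That weaker notion already fails for the specification, which settles both
negative claims. -/

namespace BAC

/-! ## Substitution and the equational theory -/

namespace Msg

theorem subst_subst (M : Msg) (τ θ : ℕ → Msg) :
    (M.subst τ).subst θ = M.subst fun i => (τ i).subst θ := by
  induction M <;> simp_all [subst]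

theorem subst_var (M : Msg) : M.subst var = M := by
  induction M <;> simp_all [subst]

theorem shift_zero (M : Msg) : M.shift 0 = M := subst_var M

theorem shift_shift (M : Msg) (m n : ℕ) : (M.shift m).shift n = M.shift (m + n) := by
  simp [shift, subst_subst, subst, Nat.add_assoc]

theorem shift_lift (M : Msg) (τ : ℕ → Msg) :
    (M.shift 1).subst (lift τ) = (M.subst τ).shift 1 := by
  simp [shift, subst_subst, subst, lift]

theorem shift_two_lift (M : Msg) (τ : ℕ → Msg) :
    (M.shift 2).subst (lift (lift τ)) = (M.subst τ).shift 2 := by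
  rw [← shift_shift M 1 1, shift_lift, shift_lift, shift_shift]

theorem shift_subst_inst (M N : Msg) : (M.shift 1).subst (inst N) = M := by
  simp [shift, subst_subst, subst, inst, subst_var]

theorem EqE.subst {M N : Msg} (h : EqE M N) (τ : ℕ → Msg) : EqE (M.subst τ) (N.subst τ) := by
  induction h with
  | refl => exact .refl _
  | symm _ ih => exact ih.symm
  | trans _ _ ih₁ ih₂ => exact ih₁.trans ih₂
  | pair _ _ ih₁ ih₂ => exact ih₁.pair ih₂
  | fst _ ih => exact ih.fst
  | snd _ ih => exact ih.snd
  | enc _ _ ih₁ ih₂ => exact ih₁.enc ih₂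
  | dec _ _ ih₁ ih₂ => exact ih₁.dec ih₂
  | mac _ _ ih₁ ih₂ => exact ih₁.mac ih₂
  | fst_pair => exact .fst_pair _ _
  | snd_pair => exact .snd_pair _ _
  | dec_enc => exact .dec_enc _ _

/-- Variable 0 does not occur in a shifted message, so substituting any message for it undoes the
shift. -/
theorem EqE.of_shift_one {M N : Msg} (h : EqE (M.shift 1) (N.shift 1)) : EqE M N := by
  simpa [shift_subst_inst] using h.subst (inst (var 0))

theorem EqE.of_shift {M N : Msg} (n : ℕ) (h : EqE (M.shift n) (N.shift n)) : EqE M N := by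
  induction n with
  | zero => simpa [shift_zero] using h
  | succ n ih => exact ih (by simpa [← shift_shift] using EqE.of_shift_one (by simpa [shift_shift] using h))

open Classical in
/-- Normal form of a message for the rewriting of destructors applied to constructors. -/
noncomputable def nf : Msg → Msg
  | var i => var i
  | ali a => ali a
  | pair M N => pair M.nf N.nf
  | fst M => match M.nf with
    | pair A _ => A
    | A => fst A
  | snd M => match M.nf with
    | pair _ B => B
    | A => snd A
  | enc M K => enc M.nf K.nf
  | dec M K => match M.nf with
    | enc A L => if L = K.nf then A else dec (enc A L) K.nf
    | A => dec A K.nf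
  | mac M K => mac M.nf K.nf

/-- `nf` of a compound message depends only on the normal forms of its parts, which gives the
congruence rules, and the three equations hold by computation. Only this direction is needed, to
separate messages; no confluence argument is involved. -/
theorem EqE.nf_eq {M N : Msg} (h : EqE M N) : M.nf = N.nf := by
  induction h with
  | dec _ _ ih₁ ih₂ => simp only [nf]; rw [ih₁, ih₂]
  | _ => simp_all [nf]

theorem EqE.var_inj {i j : ℕ} (h : EqE (var i) (var j)) : i = j := by
  simpa [nf] using h.nf_eq

theorem EqE.key_eq {M y : Msg} {i j : ℕ}
    (h : EqE (Msg.snd (Msg.pair M (Msg.mac M (var i)))) (Msg.mac y (var j))) : i = j := by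
  have := h.nf_eq
  simp [nf] at this
  exact this.2

end Msg

/-! ## Inversion of transitions -/

namespace Trans

variable {P Q : Proc} {π : Label} {u : LocLabel} {A : ExtProc} {K N : Msg}

theorem not_nil : ¬ Trans .nil π u A := by
  intro h; cases h

theorem of_nu (h : Trans (.nu P) π u A) :
    ∃ m σ R, A = ⟨m + 1, σ, R⟩ ∧ Trans P (π.shift 1) u ⟨m, σ, R⟩ := by
  cases h with | ext h => exact ⟨_, _, _, rfl, h⟩

theorem of_out (h : Trans (.out K N P) π u A) :
    ∃ M l, π = .out M ([], l) ∧ Msg.EqE M K ∧ A = ⟨0, Function.update Msg.ali ([], l) N, P⟩ := by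
  cases h with | out _ _ l h => exact ⟨_, l, rfl, h, rfl⟩

theorem of_inp (h : Trans (.inp K P) π u A) :
    ∃ M N, π = .inp M N ∧ Msg.EqE M K ∧ A = ⟨0, Msg.ali, P.subst (Msg.inst N)⟩ := by
  cases h with | inp N _ h => exact ⟨_, N, rfl, h, rfl⟩

theorem of_cond (h : Trans (.cond K N P) π u A) : Msg.EqE K N ∧ Trans P π u A := by
  cases h with | mat h e => exact ⟨e, h⟩

end Trans

/-- The components of a parallel composition. -/
def Proc.flat : Proc → Multiset Proc
  | .par P Q => P.flat + Q.flat
  | P => {P}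

theorem Proc.flat_shift (P : Proc) (m : ℕ) : (P.shift m).flat = P.flat.map (shift m) := by
  induction P with
  | par P Q ihP ihQ =>
    have : (par P Q).shift m = par (P.shift m) (Q.shift m) := rfl
    simp [this, flat, ihP, ihQ]
  | _ => simp [shift, subst, flat]

theorem Trans.exists_component {P R : Proc} {π : Label} {u : LocLabel} {m : ℕ} {σ : Alias → Msg}
    (h : Trans P π u ⟨m, σ, R⟩) (hπ : π ≠ .tau) :
    ∃ Q s u' R', P.flat = Q ::ₘ s ∧ Trans Q π u' ⟨m, σ, R'⟩ ∧
      R.flat = s.map (Proc.shift m) + R'.flat := by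
  induction P generalizing u R with
  | par P₁ P₂ ih₁ ih₂ =>
    cases h with
    | parL h =>
      obtain ⟨Q, s, u', R', e, t, e'⟩ := ih₁ h
      exact ⟨Q, s + P₂.flat, u', R', by simp [Proc.flat, e], t,
        by simp [Proc.flat, e', Proc.flat_shift]; abel⟩
    | parR h =>
      obtain ⟨Q, s, u', R', e, t, e'⟩ := ih₂ h
      exact ⟨Q, P₁.flat + s, u', R', by simp [Proc.flat, e], t,
        by simp [Proc.flat, e', Proc.flat_shift]; abel⟩
    | closeL => exact absurd rfl hπ
    | closeR => exact absurd rfl hπ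
  | _ => exact ⟨_, 0, u, R, rfl, h, by simp⟩

/-- A derivation may unfold the replication several times before a copy acts; `k` counts the idle
copies left behind. -/
theorem Trans.of_bang {P R : Proc} {π : Label} {u : LocLabel} {m : ℕ} {σ : Alias → Msg}
    (h : Trans (.bang (.nu P)) π u ⟨m, σ, R⟩) (hπ : π ≠ .tau) :
    ∃ k u' R', Trans (.nu P) π u' ⟨m, σ, R'⟩ ∧
      R.flat = Multiset.replicate k ((Proc.nu P).shift m) + {(Proc.bang (.nu P)).shift m} +
        R'.flat := by
  -- The derivation alternates between the replication and its one-step unfolding, so the induction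
  -- treats both shapes at once.
  have key : ∀ {Q A}, Trans Q π u A →
      (Q = .bang (.nu P) ∨ Q = .par (.nu P) (.bang (.nu P))) → ∀ {m σ R}, A = ⟨m, σ, R⟩ →
      ∃ k u' R', Trans (.nu P) π u' ⟨m, σ, R'⟩ ∧
      R.flat = Multiset.replicate k ((Proc.nu P).shift m) + {(Proc.bang (.nu P)).shift m} +
        R'.flat := by
    clear h
    intro Q A h
    induction h with
    | bang h ih =>
      rintro (hQ | hQ) _ _ _ rfl
      · cases hQ
        exact ih hπ (.inr rfl) rfl
      · cases hQ
    | parL h =>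
      rintro (hQ | hQ) _ _ _ hA
      · cases hQ
      · cases hQ; cases hA
        exact ⟨0, _, _, h, by simp [Proc.flat, Proc.shift, Proc.subst, add_comm]⟩
    | parR h ih =>
      rintro (hQ | hQ) _ _ _ hA
      · cases hQ
      · cases hQ; cases hA
        obtain ⟨k, u', R', t, e⟩ := ih hπ (.inl rfl) rfl
        refine ⟨k + 1, u', R', t, ?_⟩
        simp [Proc.flat, e, Multiset.replicate_succ]
        simp [Proc.flat, Proc.shift, Proc.subst]
    | closeL => exact absurd rfl hπ
    | closeR => exact absurd rfl hπ
    | _ => rintro (hQ | hQ) <;> cases hQ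
  exact key h (.inl rfl) rfl

open Msg Proc

/-! ## Components of the protocols -/

/-- A verifier that has not yet announced its channel; `r` is the index of the free channel. -/
def VStart (r ke km : ℕ) : Proc :=
  nu <| out (var (r + 1)) (var 0) <| Verifier (var 0) (var 0) (var (ke + 1)) (var (km + 1))

/-- A verifier that has received the challenge `N`. -/
def VReply (c ke km : ℕ) (N : Msg) : Proc :=
  nu <| nu <|
    let m := enc (pair (var 1) (pair (N.shift 2) (var 0))) (var (ke + 2))
    out (var (c + 2)) (pair m (mac m (var (km + 2)))) nil

/-- A prover that has not yet announced its channel; `p` is the index of the free channel. -/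
def PStart (p ke km : ℕ) : Proc :=
  nu <| out (var (p + 1)) (var 0) <| Prover (var 0) (var 0) (var (ke + 1)) (var (km + 1))

/-- A prover that has received `y` and is about to check it. -/
def PCheck (c nt ke km : ℕ) (y : Msg) : Proc :=
  cond (snd y) (mac (fst y) (var km)) <|
  cond (var nt) (fst (snd (dec (fst y) (var ke)))) <|
    nu <|
      let m := enc (pair (var (nt + 1)) (pair (fst (dec (fst (y.shift 1)) (var (ke + 1)))) (var 0)))
        (var (ke + 1))
      out (var (c + 1)) (pair m (mac m (var (km + 1)))) nil

/-- A prover that has sent its challenge. -/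
def PWait (c nt ke km : ℕ) : Proc :=
  inp (var c) <| PCheck (c + 1) (nt + 1) (ke + 1) (km + 1) (var 0)

theorem Session_shift (r p m : ℕ) (τ : ℕ → Msg) (h : ∀ i, τ i = var (i + m)) :
    (nu (nu (Session r p))).subst τ = nu (nu (Session (r + m) (p + m))) := by
  simp [Session, Verifier, Prover, Proc.subst, Msg.subst, Msg.lift, Msg.shift, h]

/-- The components of the processes reachable from `SpecCh`. -/
inductive Leaf : Type
  | spec
  | copy
  | vstart (ke km : ℕ)
  | vwait (c ke km : ℕ)
  | vreply (c ke km : ℕ) (N : Msg)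
  | pstart (ke km : ℕ)
  | pfirst (c ke km : ℕ)
  | pwait (c nt ke km : ℕ)
  | pcheck (c nt ke km : ℕ) (y : Msg)
  | done

namespace Leaf

/-- The process of a component, where `r` and `p` are the indices of the free channels. -/
def toProc (r p : ℕ) : Leaf → Proc
  | spec => SpecCh r p
  | copy => nu (nu (Session r p))
  | vstart ke km => VStart r ke km
  | vwait c ke km => Verifier (var c) (var c) (var ke) (var km)
  | vreply c ke km N => VReply c ke km N
  | pstart ke km => PStart p ke km
  | pfirst c ke km => Prover (var c) (var c) (var ke) (var km)
  | pwait c nt ke km => PWait c nt ke km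
  | pcheck c nt ke km y => PCheck c nt ke km y
  | done => nil

/-- The component placed below `m` further binders. -/
def shift (m : ℕ) : Leaf → Leaf
  | spec => spec
  | copy => copy
  | vstart ke km => vstart (ke + m) (km + m)
  | vwait c ke km => vwait (c + m) (ke + m) (km + m)
  | vreply c ke km N => vreply (c + m) (ke + m) (km + m) (N.shift m)
  | pstart ke km => pstart (ke + m) (km + m)
  | pfirst c ke km => pfirst (c + m) (ke + m) (km + m)
  | pwait c nt ke km => pwait (c + m) (nt + m) (ke + m) (km + m)
  | pcheck c nt ke km y => pcheck (c + m) (nt + m) (ke + m) (km + m) (y.shift m)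
  | done => done

/-- The private channel of a component. -/
def chan : Leaf → Option ℕ
  | vwait c _ _ => some c
  | vreply c _ _ _ => some c
  | pfirst c _ _ => some c
  | pwait c _ _ _ => some c
  | pcheck c _ _ _ _ => some c
  | _ => none

/-- The authentication key of a verifier component. -/
def vkey : Leaf → Option ℕ
  | vstart _ km => some km
  | vwait _ _ km => some km
  | vreply _ _ km _ => some km
  | _ => none

theorem toProc_shift (r p m : ℕ) (l : Leaf) :
    (l.toProc r p).shift m = (l.shift m).toProc (r + m) (p + m) := by
  cases l with
  | spec => simpa [toProc, shift, Proc.shift, SpecCh, Proc.subst] using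
      Session_shift r p m _ fun _ => rfl
  | copy => exact Session_shift r p m _ fun _ => rfl
  | _ =>
    simp [toProc, shift, Proc.shift, VStart, VReply, PStart, PWait, PCheck, Verifier, Prover,
      Proc.subst, Msg.subst, Msg.lift, Msg.shift_lift, Msg.shift_two_lift]
    try simp [Msg.shift, Msg.subst, Msg.lift]
    try omega

theorem chan_shift (m : ℕ) (l : Leaf) : (l.shift m).chan = l.chan.map (· + m) := by
  cases l <;> rfl

theorem vkey_shift (m : ℕ) (l : Leaf) : (l.shift m).vkey = l.vkey.map (· + m) := by
  cases l <;> rfl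

end Leaf
/-- `OutStep r p l M m N D`: the component `l` outputs `N` on `M`, extends the scope of `m`
restrictions and becomes `D`. -/
inductive OutStep (r p : ℕ) : Leaf → Msg → ℕ → Msg → Multiset Leaf → Prop
  | vstart {M : Msg} (ke km : ℕ) : EqE M (var r) →
      OutStep r p (.vstart ke km) M 1 (var 0) {.vwait 0 (ke + 1) (km + 1)}
  | pstart {M : Msg} (ke km : ℕ) : EqE M (var p) →
      OutStep r p (.pstart ke km) M 1 (var 0) {.pfirst 0 (ke + 1) (km + 1)}
  -- Opening a session extends the scope of `ke`, `km` and the announced channel, with indices 2, 1,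
  -- 0. `E` stands for the idle copies and the replication that remain.
  | openV {M : Msg} {l : Leaf} {E : Multiset Leaf} : EqE M (var r) → l = .copy ∨ l = .spec →
      (∀ x ∈ E, x = .copy ∨ x = .spec) →
      OutStep r p l M 3 (var 0) (E + {.vwait 0 2 1, .pstart 2 1})
  | openP {M : Msg} {l : Leaf} {E : Multiset Leaf} : EqE M (var p) → l = .copy ∨ l = .spec →
      (∀ x ∈ E, x = .copy ∨ x = .spec) →
      OutStep r p l M 3 (var 0) (E + {.vstart 2 1, .pfirst 0 2 1})
  | vreply {M : Msg} (c ke km : ℕ) (N K : Msg) : EqE M (var c) →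
      OutStep r p (.vreply c ke km N) M 2 (pair K (mac K (var (km + 2)))) {.done}
  | pfirst {M : Msg} (c ke km : ℕ) : EqE M (var c) →
      OutStep r p (.pfirst c ke km) M 1 (var 0) {.pwait (c + 1) 0 (ke + 1) (km + 1)}
  -- Only the test of the MAC is recorded; the test of the nonce plays no role in the refutation.
  | pcheck {M : Msg} (c nt ke km : ℕ) (y K : Msg) : EqE M (var c) →
      EqE (snd y) (mac (fst y) (var km)) →
      OutStep r p (.pcheck c nt ke km y) M 1 K {.done}

/-- `InpStep l M N l'`: the component `l` receives `N` on `M` and becomes `l'`. -/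
inductive InpStep : Leaf → Msg → Msg → Leaf → Prop
  | vwait {M : Msg} (c ke km : ℕ) (N : Msg) : EqE M (var c) →
      InpStep (.vwait c ke km) M N (.vreply c ke km N)
  | pwait {M : Msg} (c nt ke km : ℕ) (N : Msg) : EqE M (var c) →
      InpStep (.pwait c nt ke km) M N (.pcheck c nt ke km N)

theorem PCheck_subst_inst (c nt ke km : ℕ) (N : Msg) :
    (PCheck (c + 1) (nt + 1) (ke + 1) (km + 1) (var 0)).subst (inst N) = PCheck c nt ke km N := by
  simp [PCheck, Proc.subst, Msg.subst, Msg.lift, Msg.inst, Msg.shift]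

theorem VReply_subst_inst (c ke km : ℕ) (N : Msg) :
    (VReply (c + 1) (ke + 1) (km + 1) (var 0)).subst (inst N) = VReply c ke km N := by
  simp [VReply, Proc.subst, Msg.subst, Msg.lift, Msg.inst, Msg.shift, Msg.subst_subst]

theorem Session_eq (r p : ℕ) :
    Session r p = par (VStart (r + 2) 1 0) (PStart (p + 2) 1 0) := rfl

/-! ### Classification of the transitions of a single component -/

namespace Trans

variable {P : Proc} {K N M : Msg} {u : LocLabel} {a : Alias} {m : ℕ} {σ : Alias → Msg} {R : Proc}

theorem of_nu_out (h : Trans (.nu (.out K N P)) (.out M a) u ⟨m, σ, R⟩) :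
    m = 1 ∧ σ = Function.update Msg.ali a N ∧ R = P ∧ EqE (M.shift 1) K := by
  obtain ⟨m', σ', R', e, h⟩ := h.of_nu
  obtain ⟨M', l, e', hM, e''⟩ := h.of_out
  cases e; cases e'; cases e''
  exact ⟨rfl, rfl, rfl, hM⟩

theorem of_session {r p : ℕ} (h : Trans (.nu (.nu (Session r p))) (.out M a) u ⟨m, σ, R⟩) :
    m = 3 ∧ σ = Function.update Msg.ali a (var 0) ∧
    ((EqE M (var r) ∧ R = .par (Verifier (var 0) (var 0) (var 2) (var 1)) (PStart (p + 3) 2 1)) ∨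
     (EqE M (var p) ∧ R = .par (VStart (r + 3) 2 1) (Prover (var 0) (var 0) (var 2) (var 1)))) := by
  obtain ⟨m₁, σ₁, R₁, e, h⟩ := h.of_nu
  cases e
  obtain ⟨m₂, σ₂, R₂, e, h⟩ := h.of_nu
  cases e
  rw [Session_eq] at h
  simp only [Label.shift, Msg.shift_shift] at h
  cases h with
  | parL h' =>
    obtain ⟨rfl, rfl, rfl, hM⟩ := Trans.of_nu_out h'
    rw [Msg.shift_shift] at hM
    refine ⟨rfl, rfl, .inl ⟨EqE.of_shift 3 hM, ?_⟩⟩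
    have := Leaf.toProc_shift (r + 2) (p + 2) 1 (.pstart 1 0)
    simp only [Leaf.toProc, Leaf.shift] at this
    rw [this]
  | parR h' =>
    obtain ⟨rfl, rfl, rfl, hM⟩ := Trans.of_nu_out h'
    rw [Msg.shift_shift] at hM
    refine ⟨rfl, rfl, .inr ⟨EqE.of_shift 3 hM, ?_⟩⟩
    have := Leaf.toProc_shift (r + 2) (p + 2) 1 (.vstart 1 0)
    simp only [Leaf.toProc, Leaf.shift] at this
    rw [this]

end Trans

namespace Leaf

variable {r p : ℕ} {l : Leaf} {K N M : Msg} {u : LocLabel} {a : Alias} {m : ℕ}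
  {σ : Alias → Msg} {R : Proc}

theorem flat_toProc (r p : ℕ) (l : Leaf) : (l.toProc r p).flat = {l.toProc r p} := by
  cases l <;> rfl

theorem exists_outStep (h : Trans (l.toProc r p) (.out M a) u ⟨m, σ, R⟩) :
    ∃ N D, σ = Function.update Msg.ali a N ∧ R.flat = D.map (toProc (r + m) (p + m)) ∧
      OutStep r p l M m N D := by
  -- Shared by `copy` and `spec`: `E` is what unfolding the replication leaves beside the opened
  -- session, and is empty for `copy`.
  have session : ∀ {u R}, Trans (.nu (.nu (Session r p))) (.out M a) u ⟨m, σ, R⟩ →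
      ∀ E : Multiset Leaf, (∀ x ∈ E, x = .copy ∨ x = .spec) → l = .copy ∨ l = .spec →
      ∃ N D, σ = Function.update Msg.ali a N ∧
        E.map (toProc (r + m) (p + m)) + R.flat = D.map (toProc (r + m) (p + m)) ∧
        OutStep r p l M m N D := by
    intro u R h E hE hl
    obtain ⟨rfl, rfl, ⟨hM, rfl⟩ | ⟨hM, rfl⟩⟩ := h.of_session
    · exact ⟨_, _, rfl, by rw [Multiset.map_add]; rfl, .openV hM hl hE⟩
    · exact ⟨_, _, rfl, by rw [Multiset.map_add]; rfl, .openP hM hl hE⟩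
  cases l with
  | spec =>
    obtain ⟨k, u', R', h, e⟩ := Trans.of_bang h (by simp)
    obtain ⟨N, D, hσ, hD, ho⟩ := session h (Multiset.replicate k copy + {spec})
      (by
        intro x hx
        rcases Multiset.mem_add.1 hx with hx | hx
        · exact .inl (Multiset.eq_of_mem_replicate hx)
        · exact .inr (Multiset.mem_singleton.1 hx))
      (.inr rfl)
    refine ⟨N, D, hσ, ?_, ho⟩
    have h₁ := toProc_shift r p m copy
    have h₂ := toProc_shift r p m spec
    simp only [toProc, shift, SpecCh] at h₁ h₂
    rw [e, h₁, h₂, ← hD]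
    simp [toProc, SpecCh]
  | copy =>
    obtain ⟨N, D, hσ, hD, ho⟩ := session h 0 (by simp) (.inl rfl)
    exact ⟨N, D, hσ, by simpa using hD, ho⟩
  | vstart ke km =>
    obtain ⟨rfl, rfl, rfl, hM⟩ := h.of_nu_out
    exact ⟨_, _, rfl, rfl, .vstart ke km (EqE.of_shift 1 hM)⟩
  | pstart ke km =>
    obtain ⟨rfl, rfl, rfl, hM⟩ := h.of_nu_out
    exact ⟨_, _, rfl, rfl, .pstart ke km (EqE.of_shift 1 hM)⟩
  | pfirst c ke km =>
    obtain ⟨rfl, rfl, rfl, hM⟩ := h.of_nu_out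
    exact ⟨_, _, rfl, rfl, .pfirst c ke km (EqE.of_shift 1 hM)⟩
  | vreply c ke km N =>
    obtain ⟨m', σ', R', e, h⟩ := Trans.of_nu h
    cases e
    obtain ⟨rfl, rfl, rfl, hM⟩ := Trans.of_nu_out h
    rw [Msg.shift_shift] at hM
    exact ⟨_, _, rfl, rfl, .vreply c ke km N _ (EqE.of_shift 2 hM)⟩
  | pcheck c nt ke km y =>
    obtain ⟨hy, h⟩ := Trans.of_cond h
    obtain ⟨-, h⟩ := Trans.of_cond h
    obtain ⟨rfl, rfl, rfl, hM⟩ := Trans.of_nu_out h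
    exact ⟨_, _, rfl, rfl, .pcheck c nt ke km y _ (EqE.of_shift 1 hM) hy⟩
  | vwait c ke km => obtain ⟨M, N, e, -⟩ := Trans.of_inp h; cases e
  | pwait c nt ke km => obtain ⟨M, N, e, -⟩ := Trans.of_inp h; cases e
  | done => exact absurd h Trans.not_nil

theorem not_inp_nu_out {P : Proc} {A : ExtProc} : ¬ Trans (.nu (.out K N P)) (.inp M R') u A := by
  intro h
  obtain ⟨m', σ', R', -, h⟩ := Trans.of_nu h
  obtain ⟨M', l, e, -⟩ := h.of_out
  cases e

theorem not_inp_session {A : ExtProc} : ¬ Trans (.nu (.nu (Session r p))) (.inp M N) u A := by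
  intro h
  obtain ⟨m₁, σ₁, R₁, e, h⟩ := h.of_nu
  obtain ⟨m₂, σ₂, R₂, e, h⟩ := h.of_nu
  rw [Session_eq] at h
  cases h with
  | parL h => exact not_inp_nu_out h
  | parR h => exact not_inp_nu_out h

theorem exists_inpStep (h : Trans (l.toProc r p) (.inp M N) u ⟨m, σ, R⟩) :
    ∃ l', m = 0 ∧ R.flat = {l'.toProc r p} ∧ InpStep l M N l' := by
  cases l with
  | spec =>
    obtain ⟨k, u', R', h, e⟩ := Trans.of_bang h (by simp)
    exact absurd h not_inp_session
  | copy => exact absurd h not_inp_session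
  | vwait c ke km =>
    obtain ⟨M, N, e, hM, e'⟩ := Trans.of_inp h
    cases e; cases e'
    refine ⟨.vreply c ke km N, rfl, ?_, .vwait c ke km N hM⟩
    rw [← flat_toProc]
    exact congrArg flat (VReply_subst_inst c ke km N)
  | pwait c nt ke km =>
    obtain ⟨M, N, e, hM, e'⟩ := Trans.of_inp h
    cases e; cases e'
    refine ⟨.pcheck c nt ke km N, rfl, ?_, .pwait c nt ke km N hM⟩
    rw [← flat_toProc]
    exact congrArg flat (PCheck_subst_inst c nt ke km N)
  | vreply c ke km N =>
    obtain ⟨m', σ', R', e, h⟩ := Trans.of_nu h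
    exact absurd h not_inp_nu_out
  | pcheck c nt ke km y =>
    obtain ⟨hy, h⟩ := Trans.of_cond h
    obtain ⟨-, h⟩ := Trans.of_cond h
    exact absurd h not_inp_nu_out
  | done => exact absurd h Trans.not_nil
  | _ => exact absurd h not_inp_nu_out

end Leaf
-- Uniqueness of private channels and verifier keys
-- Idle components carry shifted values, at least `m`. A new value is either a fresh index below `m`
-- or inherited from the acting component `l`, whose value no idle component shared.
theorem Leaf.nodup_step {f : Leaf → Option ℕ} (hf : ∀ m l, f (l.shift m) = (f l).map (· + m))
    {l : Leaf} {m : ℕ} {D₀ D₁ : Multiset Leaf} (h : ((l ::ₘ D₀).filterMap f).Nodup)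
    (h₁ : (D₁.filterMap f).Nodup)
    (h₂ : ∀ x ∈ D₁, ∀ k, f x = some k → k < m ∨ ∃ k', f l = some k' ∧ k = k' + m) :
    ((D₀.map (Leaf.shift m) + D₁).filterMap f).Nodup := by
  have e : (D₀.map (Leaf.shift m)).filterMap f = (D₀.filterMap f).map (· + m) := by
    rw [Multiset.filterMap_map, Multiset.map_filterMap]
    exact congrArg (Multiset.filterMap · D₀) (funext (hf m))
  have h₀ : (D₀.filterMap f).Nodup := by
    refine Multiset.nodup_of_le (Multiset.filterMap_le_filterMap f ?_) h
    exact Multiset.le_cons_self _ _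
  rw [Multiset.filterMap_add, e, Multiset.nodup_add]
  refine ⟨h₀.map (add_left_injective m), h₁, Multiset.disjoint_left.2 fun {k} hk hk' => ?_⟩
  obtain ⟨k₀, hk₀, rfl⟩ := Multiset.mem_map.1 hk
  obtain ⟨x, hx, hxk⟩ := (Multiset.mem_filterMap f _).1 hk'
  rcases h₂ x hx _ hxk with hlt | ⟨k', hl, e'⟩
  · exact absurd hlt (by simp)
  · obtain rfl : k₀ = k' := by simpa using e'
    rw [Multiset.filterMap_cons_some f l D₀ hl] at h
    exact (Multiset.nodup_cons.1 h).1 hk₀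

theorem Leaf.eq_of_nodup {f : Leaf → Option ℕ} {D : Multiset Leaf} (h : (D.filterMap f).Nodup)
    {x y : Leaf} (hx : x ∈ D) (hy : y ∈ D) {k : ℕ} (hxk : f x = some k) (hyk : f y = some k) :
    x = y := by
  by_contra hne
  obtain ⟨D', rfl⟩ := Multiset.exists_cons_of_mem hx
  have hy' : y ∈ D' := (Multiset.mem_cons.1 hy).resolve_left (Ne.symm hne)
  rw [Multiset.filterMap_cons_some f x D' hxk] at h
  exact (Multiset.nodup_cons.1 h).1 ((Multiset.mem_filterMap f _).2 ⟨y, hy', hyk⟩)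

namespace OutStep

variable {r p m : ℕ} {l : Leaf} {M N : Msg} {D : Multiset Leaf}

theorem filterMap_eq_zero {f : Leaf → Option ℕ} (hc : f .copy = none) (hs : f .spec = none)
    {E : Multiset Leaf} (h : ∀ x ∈ E, x = .copy ∨ x = .spec) : E.filterMap f = 0 := by
  refine Multiset.eq_zero_of_forall_notMem fun k hk => ?_
  obtain ⟨x, hx, e⟩ := (Multiset.mem_filterMap f _).1 hk
  rcases h x hx with rfl | rfl <;> simp_all

theorem new_chan (h : OutStep r p l M m N D) : (D.filterMap Leaf.chan).Nodup ∧
    ∀ x ∈ D, ∀ k, x.chan = some k → k < m ∨ ∃ k', l.chan = some k' ∧ k = k' + m := by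
  cases h with
  | openV hM hl hE =>
    rw [Multiset.filterMap_add, filterMap_eq_zero rfl rfl hE]
    refine ⟨by decide, fun x hx k hk => ?_⟩
    rcases Multiset.mem_add.1 hx with hx | hx
    · rcases hE x hx with rfl | rfl <;> simp [Leaf.chan] at hk
    · simp at hx; rcases hx with rfl | rfl <;> simp [Leaf.chan] at hk; omega
  | openP hM hl hE =>
    rw [Multiset.filterMap_add, filterMap_eq_zero rfl rfl hE]
    refine ⟨by decide, fun x hx k hk => ?_⟩
    rcases Multiset.mem_add.1 hx with hx | hx
    · rcases hE x hx with rfl | rfl <;> simp [Leaf.chan] at hk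
    · simp at hx; rcases hx with rfl | rfl <;> simp [Leaf.chan] at hk; omega
  | _ =>
    exact ⟨by first | exact List.nodup_nil | exact List.nodup_singleton _, by simp [Leaf.chan]⟩

theorem new_vkey (h : OutStep r p l M m N D) : (D.filterMap Leaf.vkey).Nodup ∧
    ∀ x ∈ D, ∀ k, x.vkey = some k → k < m ∨ ∃ k', l.vkey = some k' ∧ k = k' + m := by
  cases h with
  | openV hM hl hE =>
    rw [Multiset.filterMap_add, filterMap_eq_zero rfl rfl hE]
    refine ⟨by decide, fun x hx k hk => ?_⟩
    rcases Multiset.mem_add.1 hx with hx | hx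
    · rcases hE x hx with rfl | rfl <;> simp [Leaf.vkey] at hk
    · simp at hx; rcases hx with rfl | rfl <;> simp [Leaf.vkey] at hk; omega
  | openP hM hl hE =>
    rw [Multiset.filterMap_add, filterMap_eq_zero rfl rfl hE]
    refine ⟨by decide, fun x hx k hk => ?_⟩
    rcases Multiset.mem_add.1 hx with hx | hx
    · rcases hE x hx with rfl | rfl <;> simp [Leaf.vkey] at hk
    · simp at hx; rcases hx with rfl | rfl <;> simp [Leaf.vkey] at hk; omega
  | _ =>
    exact ⟨by first | exact List.nodup_nil | exact List.nodup_singleton _, by simp [Leaf.vkey]⟩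

/-- A component with a private channel outputs on that channel only. -/
theorem eqE_chan (h : OutStep r p l M m N D) {c : ℕ} (hc : l.chan = some c) : EqE M (var c) := by
  cases h with
  | openV _ hl | openP _ hl => rcases hl with rfl | rfl <;> simp [Leaf.chan] at hc
  | _ => simp_all [Leaf.chan]

end OutStep

/-- The components of `A` are those of `D`; private channels and the authentication keys of
verifiers are not shared between components. -/
structure Inv (r p : ℕ) (A : ExtProc) (D : Multiset Leaf) : Prop where
  flat : A.P.flat = D.map (Leaf.toProc (r + A.n) (p + A.n))
  chan_lt : ∀ l ∈ D, ∀ c, l.chan = some c → c < A.n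
  chan_nodup : (D.filterMap Leaf.chan).Nodup
  vkey_nodup : (D.filterMap Leaf.vkey).Nodup

/-! ### Preservation of the invariant by outputs and inputs -/

namespace Inv

variable {r p : ℕ} {A B : ExtProc} {D : Multiset Leaf} {M N : Msg} {a : Alias} {u : LocLabel}

theorem exists_component (hA : Inv r p A D) {π : Label} {m : ℕ} {σ : Alias → Msg} {R : Proc}
    (h : Trans A.P π u ⟨m, σ, R⟩) (hπ : π ≠ .tau) :
    ∃ l D₀ u' R', D = l ::ₘ D₀ ∧ Trans (l.toProc (r + A.n) (p + A.n)) π u' ⟨m, σ, R'⟩ ∧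
      R.flat = (D₀.map (Leaf.shift m)).map (Leaf.toProc (r + A.n + m) (p + A.n + m)) +
        R'.flat := by
  classical
  obtain ⟨Q, s, u', R', e, t, e'⟩ := h.exists_component hπ
  rw [hA.flat, ← Multiset.map_eq_cons] at e
  obtain ⟨l, hl, rfl, rfl⟩ := e
  refine ⟨l, D.erase l, u', R', (Multiset.cons_erase hl).symm, t, ?_⟩
  rw [e', Multiset.map_map, Multiset.map_map]
  congr 2
  exact funext fun x => x.toProc_shift _ _ m

theorem exists_out (hA : Inv r p A D) (h : ETrans A (.out M a) u B) :
    ∃ l ∈ D, ∃ m D₁ D', Inv r p B D' ∧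
      OutStep (r + A.n) (p + A.n) l ((M.shift A.n).aliasSubst A.σ) m (B.σ a) D₁ ∧
      (∀ b, A.σ b ≠ ali b → B.σ b = (A.σ b).shift m) ∧
      (∀ y ∈ D, y ≠ l → y.shift m ∈ D') ∧ ∀ y ∈ D₁, y ∈ D' := by
  cases h with
  | @aliasOut n m σ P Q _ N s t i h hM ha =>
    obtain ⟨l, D₀, u', R', rfl, t, e⟩ := hA.exists_component h (by simp)
    obtain ⟨N', D₁, hN, hR, ho⟩ := l.exists_outStep t
    -- Both updates describe the same active substitution; evaluation at the new alias recovers the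
    -- message.
    obtain rfl : N = N' := by simpa using congrFun hN ([], i)
    refine ⟨l, by simp, m, D₁, D₀.map (Leaf.shift m) + D₁, ⟨?_, ?_, ?_, ?_⟩, by simpa using ho,
      ?_, ?_, ?_⟩
    · rw [Multiset.map_add]
      simpa [hR, add_assoc] using e
    · intro x hx c hc
      have hlt := hA.chan_lt
      rcases Multiset.mem_add.1 hx with hx | hx
      · obtain ⟨y, hy, rfl⟩ := Multiset.mem_map.1 hx
        rw [Leaf.chan_shift] at hc
        obtain ⟨c', hc', rfl⟩ := Option.map_eq_some_iff.1 hc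
        exact Nat.add_lt_add_right (hlt y (Multiset.mem_cons_of_mem hy) c' hc') m
      · rcases ho.new_chan.2 x hx c hc with h | ⟨c', hc', rfl⟩
        · exact Nat.lt_add_left n h
        · exact Nat.add_lt_add_right (hlt l (Multiset.mem_cons_self _ _) c' hc') m
    · exact Leaf.nodup_step Leaf.chan_shift hA.chan_nodup ho.new_chan.1 ho.new_chan.2
    · exact Leaf.nodup_step Leaf.vkey_shift hA.vkey_nodup ho.new_vkey.1 ho.new_vkey.2
    · intro b hb
      have : b ≠ (s, i) := by rintro rfl; exact ha hb
      simp [this]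
    · intro y hy hne
      exact Multiset.mem_add.2 (.inl (Multiset.mem_map_of_mem _ ((Multiset.mem_cons.1 hy).resolve_left hne)))
    · exact fun y hy => Multiset.mem_add.2 (.inr hy)

theorem _root_.BAC.Leaf.shift_zero (l : Leaf) : l.shift 0 = l := by
  cases l <;> simp [Leaf.shift, Msg.shift_zero]

theorem exists_inp (hA : Inv r p A D) (h : ETrans A (.inp M N) u B) :
    ∃ l ∈ D, ∃ l' D', Inv r p B D' ∧
      InpStep l ((M.shift A.n).aliasSubst A.σ) ((N.shift A.n).aliasSubst A.σ) l' ∧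
      B.σ = A.σ ∧ (∀ y ∈ D, y ≠ l → y ∈ D') ∧ l' ∈ D' := by
  cases h with
  | @aliasInp n m σ P Q _ _ _ h hM hN =>
    obtain ⟨l, D₀, u', R', rfl, t, e⟩ := hA.exists_component h (by simp)
    obtain ⟨l', rfl, hR, hi⟩ := l.exists_inpStep t
    have hs : Leaf.shift 0 = id := funext Leaf.shift_zero
    rw [hs, Multiset.map_id] at e
    have key : ∀ f : Leaf → Option ℕ, f l' = f l →
        (l' ::ₘ D₀).filterMap f = (l ::ₘ D₀).filterMap f := by
      intro f hf
      simp [Multiset.filterMap_cons, hf]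
    -- A reception changes neither channel nor key, so both uniqueness statements carry over
    -- unchanged.
    have hc : l'.chan = l.chan := by cases hi <;> rfl
    have hv : l'.vkey = l.vkey := by cases hi <;> rfl
    refine ⟨l, by simp, l', l' ::ₘ D₀, ⟨?_, ?_, ?_, ?_⟩, hi, ?_, ?_, by simp⟩
    · simpa [hR] using e.trans (add_comm _ _)
    · intro x hx c hxc
      rcases Multiset.mem_cons.1 hx with rfl | hx
      · exact hA.chan_lt l (by simp) c (hc ▸ hxc)
      · exact hA.chan_lt x (by simp [hx]) c hxc
    · rw [key _ hc]; exact hA.chan_nodup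
    · rw [key _ hv]; exact hA.vkey_nodup
    · simp [Msg.shift_zero]
    · intro y hy hne
      exact Multiset.mem_cons_of_mem ((Multiset.mem_cons.1 hy).resolve_left hne)

/-- An output on a channel recorded as that of the component `x` is performed by `x`. -/
theorem exists_out_chan (hA : Inv r p A D) {x : Leaf} {b : Alias} {c : ℕ} (hx : x ∈ D)
    (hc : x.chan = some c) (hb : A.σ b = var c) (h : ETrans A (.out (ali b) a) u B) :
    ∃ m D₁ D', Inv r p B D' ∧ OutStep (r + A.n) (p + A.n) x (var c) m (B.σ a) D₁ ∧
      (∀ b, A.σ b ≠ ali b → B.σ b = (A.σ b).shift m) ∧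
      (∀ y ∈ D, y ≠ x → y.shift m ∈ D') ∧ ∀ y ∈ D₁, y ∈ D' := by
  obtain ⟨l, hl, m, D₁, D', hB, ho, hσ, hD, hD₁⟩ := hA.exists_out h
  simp only [Msg.shift, Msg.subst, Msg.aliasSubst, hb] at ho
  obtain rfl : l = x := by
    have hlt := hA.chan_lt x hx c hc
    rcases hlc : l.chan with _ | c'
    -- A component without a private channel outputs only on `r` or `p`, whose indices here are at
    -- least `A.n`, while `c < A.n`.
    · generalize B.σ a = N at ho
      cases ho with
      | vstart _ _ e | pstart _ _ e | openV e | openP e => have := e.var_inj; omega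
      | _ => simp [Leaf.chan] at hlc
    · obtain rfl := (ho.eqE_chan hlc).var_inj
      exact Leaf.eq_of_nodup hA.chan_nodup hl hx hlc hc
  exact ⟨m, D₁, D', hB, ho, hσ, hD, hD₁⟩

/-- An input on a channel recorded as that of the component `x` is performed by `x`. -/
theorem exists_inp_chan (hA : Inv r p A D) {x : Leaf} {b b' : Alias} {c : ℕ} (hx : x ∈ D)
    (hc : x.chan = some c) (hb : A.σ b = var c) (h : ETrans A (.inp (ali b) (ali b')) u B) :
    ∃ x' D', Inv r p B D' ∧ InpStep x (var c) (A.σ b') x' ∧ B.σ = A.σ ∧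
      (∀ y ∈ D, y ≠ x → y ∈ D') ∧ x' ∈ D' := by
  obtain ⟨l, hl, l', D', hB, hi, hσ, hD, hl'⟩ := hA.exists_inp h
  simp only [Msg.shift, Msg.subst, Msg.aliasSubst, hb] at hi
  obtain rfl : l = x := by
    have hlc : l.chan = some c := by
      cases hi with
      | vwait _ _ _ _ e => rw [Leaf.chan, ← e.var_inj]
      | pwait _ _ _ _ _ e => rw [Leaf.chan, ← e.var_inj]
    exact Leaf.eq_of_nodup hA.chan_nodup hl hx hlc hc
  exact ⟨l', D', hB, hi, hσ, hD, hl'⟩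

/-- An output on the free channel `p` comes from a prover, which announces its channel. -/
theorem exists_out_prover (hrp : r ≠ p) (hA : Inv r p A D) (h : ETrans A (.out (var p) a) u B) :
    ∃ m D' ke km, Inv r p B D' ∧ B.σ a = var 0 ∧ .pfirst 0 ke km ∈ D' ∧
      (∀ b, A.σ b ≠ ali b → B.σ b = (A.σ b).shift m) ∧
      ∀ y ∈ D, y.chan ≠ none → y.shift m ∈ D' := by
  obtain ⟨l, hl, m, D₁, D', hB, ho, hσ, hD, hD₁⟩ := hA.exists_out h
  simp only [Msg.shift, Msg.subst, Msg.aliasSubst] at ho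
  -- The free channel has index at least `A.n`, above all private channels. Hence the components
  -- that own a private channel are idle in this step.
  have hlc : l.chan = none := by
    by_contra hne
    obtain ⟨c, hc⟩ := Option.ne_none_iff_exists'.1 hne
    have := hA.chan_lt l hl c hc
    have := (ho.eqE_chan hc).var_inj
    omega
  have hD' : ∀ y ∈ D, y.chan ≠ none → y.shift m ∈ D' :=
    fun y hy hne => hD y hy (by rintro rfl; exact hne hlc)
  generalize B.σ a = N at ho ⊢
  cases ho with
  | vstart _ _ e | openV e => have := e.var_inj; omega
  | pstart ke km e => exact ⟨_, D', ke + 1, km + 1, hB, rfl, hD₁ _ (by simp), hσ, hD'⟩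
  | openP e => exact ⟨_, D', 2, 1, hB, rfl, hD₁ _ (by simp), hσ, hD'⟩
  | _ => simp [Leaf.chan] at hlc

/-- An output on the free channel `r` comes from a verifier, which announces its channel. -/
theorem exists_out_verifier (hrp : r ≠ p) (hA : Inv r p A D) (h : ETrans A (.out (var r) a) u B) :
    ∃ m D' ke km, Inv r p B D' ∧ B.σ a = var 0 ∧ .vwait 0 ke km ∈ D' ∧ 0 < m ∧
      (∀ b, A.σ b ≠ ali b → B.σ b = (A.σ b).shift m) ∧
      ∀ y ∈ D, y.chan ≠ none → y.shift m ∈ D' := by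
  obtain ⟨l, hl, m, D₁, D', hB, ho, hσ, hD, hD₁⟩ := hA.exists_out h
  simp only [Msg.shift, Msg.subst, Msg.aliasSubst] at ho
  have hlc : l.chan = none := by
    by_contra hne
    obtain ⟨c, hc⟩ := Option.ne_none_iff_exists'.1 hne
    have := hA.chan_lt l hl c hc
    have := (ho.eqE_chan hc).var_inj
    omega
  have hD' : ∀ y ∈ D, y.chan ≠ none → y.shift m ∈ D' :=
    fun y hy hne => hD y hy (by rintro rfl; exact hne hlc)
  generalize B.σ a = N at ho ⊢
  cases ho with
  | pstart _ _ e | openP e => have := e.var_inj; omega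
  | vstart ke km e => exact ⟨_, D', ke + 1, km + 1, hB, rfl, hD₁ _ (by simp), by simp, hσ, hD'⟩
  | openV e => exact ⟨_, D', 2, 1, hB, rfl, hD₁ _ (by simp), by simp, hσ, hD'⟩
  | _ => simp [Leaf.chan] at hlc

theorem init (r p : ℕ) : Inv r p (ExtProc.ofProc (SpecCh r p)) {.spec} :=
  ⟨rfl, by simp [Leaf.chan], List.nodup_nil,
    List.nodup_nil⟩

end Inv
/-! ## Formulas without negation and interaction, up to freshness -/

/-- Satisfaction of formulas built from `true`, conjunction, input and output modalities; the
alias of an output is not required to be fresh for the formula. -/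
inductive PosSat : ExtProc → Formula → Prop
  | top (A : ExtProc) : PosSat A .top
  | conj {A : ExtProc} {φ ψ : Formula} : PosSat A φ → PosSat A ψ → PosSat A (.conj φ ψ)
  | diaInp {A B : ExtProc} {M N : Msg} {φ : Formula} {u : LocLabel} :
      ETrans A (.inp M N) u B → PosSat B φ → PosSat A (.diaInp M N φ)
  | diaOut {A B : ExtProc} {M : Msg} {φ : Formula} {u : LocLabel} {a : Alias} :
      ETrans A (.out M a) u B → PosSat B (φ.subst (inst (ali a))) → PosSat A (.diaOut M φ)

namespace Formula

/-- Formulas built from `true`, conjunction, input and output modalities. -/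
def Positive : Formula → Prop
  | top => True
  | conj φ ψ => φ.Positive ∧ ψ.Positive
  | diaInp _ _ φ => φ.Positive
  | diaOut _ φ => φ.Positive
  | _ => False

theorem Positive.subst {φ : Formula} (h : φ.Positive) : ∀ τ, (φ.subst τ).Positive := by
  induction φ <;> intro τ <;> simp_all [Formula.subst, Positive]

/-- Renaming of the aliases of a formula. -/
def renameAlias (ρ : Alias → Alias) : Formula → Formula
  | top => top
  | eq M N => eq (M.renameAlias ρ) (N.renameAlias ρ)
  | conj φ ψ => conj (φ.renameAlias ρ) (ψ.renameAlias ρ)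
  | neg φ => neg (φ.renameAlias ρ)
  | diaTau φ => diaTau (φ.renameAlias ρ)
  | diaInp M N φ => diaInp (M.renameAlias ρ) (N.renameAlias ρ) (φ.renameAlias ρ)
  | diaOut M φ => diaOut (M.renameAlias ρ) (φ.renameAlias ρ)

theorem _root_.BAC.Msg.renameAlias_subst {ρ ρ' : Alias → Alias} {M : Msg} (τ : ℕ → Msg)
    (h : ∀ a ∈ M.fal, ρ' a = ρ a) :
    (M.subst τ).renameAlias ρ' = (M.renameAlias ρ).subst fun i => (τ i).renameAlias ρ' := by
  induction M <;> simp_all [Msg.renameAlias, Msg.subst, Msg.aliasSubst, Msg.fal]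

theorem _root_.BAC.Msg.renameAlias_shift (ρ : Alias → Alias) (M : Msg) (n : ℕ) :
    (M.shift n).renameAlias ρ = (M.renameAlias ρ).shift n :=
  Msg.renameAlias_subst _ fun _ _ => rfl

theorem renameAlias_subst {ρ ρ' : Alias → Alias} {φ : Formula} : ∀ (τ : ℕ → Msg),
    (∀ a ∈ φ.fal, ρ' a = ρ a) →
    (φ.subst τ).renameAlias ρ' = (φ.renameAlias ρ).subst fun i => (τ i).renameAlias ρ' := by
  induction φ with
  | top => intros; rfl
  | eq M N =>
    intro τ h
    simp only [renameAlias, subst]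
    rw [Msg.renameAlias_subst τ fun a ha => h a (.inl ha),
      Msg.renameAlias_subst τ fun a ha => h a (.inr ha)]
  | conj φ ψ ihφ ihψ =>
    intro τ h
    simp only [renameAlias, subst]
    rw [ihφ τ fun a ha => h a (.inl ha), ihψ τ fun a ha => h a (.inr ha)]
  | neg φ ih => intro τ h; simp only [renameAlias, subst]; rw [ih τ h]
  | diaTau φ ih => intro τ h; simp only [renameAlias, subst]; rw [ih τ h]
  | diaInp M N φ ih =>
    intro τ h
    simp only [renameAlias, subst]
    rw [Msg.renameAlias_subst τ fun a ha => h a (.inl (.inl ha)),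
      Msg.renameAlias_subst τ fun a ha => h a (.inl (.inr ha)), ih τ fun a ha => h a (.inr ha)]
  | diaOut M φ ih =>
    intro τ h
    simp only [renameAlias, subst]
    rw [Msg.renameAlias_subst τ fun a ha => h a (.inl ha), ih _ fun a ha => h a (.inr ha)]
    congr 2
    funext i
    cases i with
    | zero => rfl
    | succ i => exact Msg.renameAlias_shift ρ' (τ i) 1

/-- Matches the update of `ρ` in the output clause of a simulation with the instantiation of the
bound variable: as `a` is fresh for `φ`, the update affects only the occurrences just substituted.
-/
theorem renameAlias_inst {ρ : Alias → Alias} {φ : Formula} {a : Alias} (a' : Alias)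
    (ha : a ∉ φ.fal) :
    (φ.subst (inst (ali a))).renameAlias (Function.update ρ a a') =
      (φ.renameAlias ρ).subst (inst (ali a')) := by
  rw [renameAlias_subst (ρ := ρ) _ fun b hb => Function.update_of_ne (by rintro rfl; exact ha hb) _ _]
  congr 1
  funext i
  cases i with
  | zero => simp [inst, Msg.renameAlias, Msg.aliasSubst]
  | succ i => rfl

end Formula

theorem Sat.posSat {A : ExtProc} {φ : Formula} (h : Sat A φ) (hφ : φ.Positive) : PosSat A φ := by
  -- The output case continues with an instance of the body, not with the body itself, hence
  -- induction on size.
  induction hn : φ.size using Nat.strong_induction_on generalizing A φ with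
  | _ n ih =>
    subst hn
    cases φ with
    | top => exact .top A
    | conj φ ψ =>
      rw [Sat] at h
      exact .conj (ih _ (by simp only [Formula.size]; omega) h.1 hφ.1 rfl)
        (ih _ (by simp only [Formula.size]; omega) h.2 hφ.2 rfl)
    | diaInp M N φ =>
      rw [Sat] at h
      obtain ⟨u, B, t, h⟩ := h
      exact .diaInp t (ih _ (by simp [Formula.size]) h hφ rfl)
    | diaOut M φ =>
      rw [Sat] at h
      obtain ⟨u, a, B, t, -, h⟩ := h
      exact .diaOut t (ih _ (by simp [Formula.size, Formula.size_subst]) h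
        (Formula.Positive.subst (φ := φ) hφ _) rfl)
    | _ => exact absurd hφ id

/-- Interleaving simulations preserve positive formulas. -/
theorem IsISimulation.posSat {R : (Alias → Alias) → ExtProc → ExtProc → Prop}
    (hR : IsISimulation R) {ρ : Alias → Alias} {A B : ExtProc} {φ : Formula} (hAB : R ρ A B)
    (h : Sat A φ) (hφ : φ.Positive) : PosSat B (φ.renameAlias ρ) := by
  induction hn : φ.size using Nat.strong_induction_on generalizing A B φ ρ with
  | _ n ih =>
    subst hn
    cases φ with
    | top => exact .top B
    | conj φ ψ =>
      rw [Sat] at h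
      exact .conj (ih _ (by simp only [Formula.size]; omega) hAB h.1 hφ.1 rfl)
        (ih _ (by simp only [Formula.size]; omega) hAB h.2 hφ.2 rfl)
    | diaInp M N φ =>
      rw [Sat] at h
      obtain ⟨u, A', t, h⟩ := h
      obtain ⟨u', B', t', hAB'⟩ := hR.inp hAB t
      exact .diaInp t' (ih _ (by simp [Formula.size]) hAB' h hφ rfl)
    | diaOut M φ =>
      rw [Sat] at h
      obtain ⟨u, a, A', t, ha, h⟩ := h
      obtain ⟨u', a', B', t', hAB'⟩ := hR.out hAB t
      refine .diaOut t' ?_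
      rw [← Formula.renameAlias_inst a' ha]
      exact ih _ (by simp [Formula.size, Formula.size_subst]) hAB' h
        (Formula.Positive.subst (φ := φ) hφ _) rfl
    | _ => exact absurd hφ id

theorem attackFormula_positive (r p : ℕ) : (attackFormula r p).Positive := by
  simp [attackFormula, Formula.Positive]

/-! ### Refutation of the attack formula in the specification -/

namespace PosSat

variable {A : ExtProc} {M N : Msg} {φ ψ : Formula}

theorem of_conj (h : PosSat A (.conj φ ψ)) : PosSat A φ ∧ PosSat A ψ := by
  cases h with | conj h₁ h₂ => exact ⟨h₁, h₂⟩

theorem of_diaInp (h : PosSat A (.diaInp M N φ)) :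
    ∃ u B, ETrans A (.inp M N) u B ∧ PosSat B φ := by
  cases h with | diaInp t h => exact ⟨_, _, t, h⟩

theorem of_diaOut (h : PosSat A (.diaOut M φ)) :
    ∃ u a B, ETrans A (.out M a) u B ∧ PosSat B (φ.subst (inst (ali a))) := by
  cases h with | diaOut t h => exact ⟨_, _, _, t, h⟩

end PosSat

/-- A prover accepts a reply only if it is authenticated by its own key. -/
theorem Inv.key_eq {r p : ℕ} {A : ExtProc} {D : Multiset Leaf} (hA : Inv r p A D)
    {c nt ke km k : ℕ} {K : Msg} {a b : Alias} (hx : .pwait c nt ke km ∈ D)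
    (ha : A.σ a = var c) (hb : A.σ b = pair K (mac K (var k)))
    (h : PosSat A (.diaInp (ali a) (ali b) (.diaOut (ali a) .top))) : k = km := by
  obtain ⟨u, B, t, h⟩ := h.of_diaInp
  obtain ⟨u', w, C, t', -⟩ := h.of_diaOut
  obtain ⟨x', D', hB, hi, hσ, -, hx'⟩ := hA.exists_inp_chan hx rfl ha t
  rw [hb] at hi
  cases hi with
  | pwait =>
    obtain ⟨m, D₁, D'', -, ho, -⟩ := hB.exists_out_chan hx' rfl (by rw [hσ, ha]) t'
    generalize C.σ w = N at ho
    cases ho with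
    | pcheck _ _ _ _ _ _ _ e => exact e.key_eq
    | openV _ hl | openP _ hl => simp at hl

namespace Inv

variable {r p : ℕ} {A B : ExtProc} {D : Multiset Leaf} {a b b' : Alias} {u : LocLabel}
  {c ke km : ℕ} {N : Msg}

theorem exists_out_pfirst (hA : Inv r p A D) (hx : .pfirst c ke km ∈ D) (hb : A.σ b = var c)
    (h : ETrans A (.out (ali b) a) u B) :
    ∃ D', Inv r p B D' ∧ .pwait (c + 1) 0 (ke + 1) (km + 1) ∈ D' ∧
      (∀ b, A.σ b ≠ ali b → B.σ b = (A.σ b).shift 1) ∧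
      ∀ y ∈ D, y ≠ .pfirst c ke km → y.shift 1 ∈ D' := by
  obtain ⟨m, E, D', hB, ho, hσ, hD, hE⟩ := hA.exists_out_chan hx rfl hb h
  generalize B.σ a = N at ho
  cases ho with
  | pfirst => exact ⟨D', hB, hE _ (by simp), hσ, hD⟩
  | openV _ hl | openP _ hl => simp at hl

theorem exists_out_vreply (hA : Inv r p A D) (hx : .vreply c ke km N ∈ D) (hb : A.σ b = var c)
    (h : ETrans A (.out (ali b) a) u B) :
    ∃ D' K, Inv r p B D' ∧ B.σ a = pair K (mac K (var (km + 2))) ∧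
      (∀ b, A.σ b ≠ ali b → B.σ b = (A.σ b).shift 2) ∧
      ∀ y ∈ D, y ≠ .vreply c ke km N → y.shift 2 ∈ D' := by
  obtain ⟨m, E, D', hB, ho, hσ, hD, hE⟩ := hA.exists_out_chan hx rfl hb h
  generalize B.σ a = N' at ho ⊢
  cases ho with
  | vreply _ _ _ _ K => exact ⟨D', K, hB, rfl, hσ, hD⟩
  | openV _ hl | openP _ hl => simp at hl

theorem exists_inp_vwait (hA : Inv r p A D) (hx : .vwait c ke km ∈ D) (hb : A.σ b = var c)
    (h : ETrans A (.inp (ali b) (ali b')) u B) :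
    ∃ D' N, Inv r p B D' ∧ .vreply c ke km N ∈ D' ∧ B.σ = A.σ ∧
      ∀ y ∈ D, y ≠ .vwait c ke km → y ∈ D' := by
  obtain ⟨x', D', hB, hi, hσ, hD, hx'⟩ := hA.exists_inp_chan hx rfl hb h
  cases hi with
  | vwait => exact ⟨D', _, hB, hx', hσ, hD⟩

end Inv

theorem Msg.var_shift (i n : ℕ) : (var i).shift n = var (i + n) := rfl

set_option linter.unusedSimpArgs false in
theorem not_posSat_SpecCh {r p : ℕ} (hrp : r ≠ p) :
    ¬ PosSat (ExtProc.ofProc (SpecCh r p)) (attackFormula r p) := by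
  intro h
  unfold attackFormula at h
  obtain ⟨_, a₁, A₁, t, h⟩ := h.of_diaOut
  -- Throughout, `x₁`, `x₂`, `x₃` locate the prover and the two verifiers among the components, and
  -- `s₁`, `s₂`, `s₃` record their channels in the active substitution. Each output shifts all of
  -- them.
  obtain ⟨-, D₁, e₁, k₁, I₁, s₁, x₁, -, -⟩ := (Inv.init r p).exists_out_prover hrp t
  simp only [Formula.subst, Msg.subst, Msg.lift, Msg.inst, Msg.shift] at h
  obtain ⟨_, a₂, A₂, t, h⟩ := h.of_diaOut
  obtain ⟨m, D₂, e₂, k₂, I₂, s₂, x₂, -, S, hD⟩ := I₁.exists_out_verifier hrp t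
  replace x₁ := hD _ x₁ (by simp [Leaf.chan])
  replace s₁ := (S a₁ (by simp [s₁])).trans (congrArg (Msg.shift m) s₁)
  simp only [Formula.subst, Msg.subst, Msg.lift, Msg.inst, Msg.shift] at h
  obtain ⟨_, a₃, A₃, t, h⟩ := h.of_diaOut
  clear S hD
  obtain ⟨m', D₃, e₃, k₃, I₃, s₃, x₃, hm, S, hD⟩ := I₂.exists_out_verifier hrp t
  replace x₁ := hD _ x₁ (by simp [Leaf.chan, Leaf.shift])
  replace x₂ := hD _ x₂ (by simp [Leaf.chan])
  replace s₁ := (S a₁ (by simp [s₁, var_shift])).trans (congrArg (Msg.shift m') s₁)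
  replace s₂ := (S a₂ (by simp [s₂])).trans (congrArg (Msg.shift m') s₂)
  simp only [Formula.subst, Msg.subst, Msg.lift, Msg.inst, Msg.shift] at h
  simp only [Leaf.shift, var_shift] at x₁ x₂ s₁ s₂
  -- With equal keys the two verifiers would be the same component; but their channels are `0 + m'`
  -- and `0`, and `m'` is positive.
  have hk : k₂ + m' ≠ k₃ := by
    intro e
    have := Leaf.eq_of_nodup I₃.vkey_nodup x₂ x₃ rfl (congrArg some e.symm)
    simp at this
    omega
  generalize 0 + m + m' = c₁ at x₁ s₁
  generalize e₁ + m + m' = e₁ at x₁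
  generalize k₁ + m + m' = k₁ at x₁
  have hc : 0 + m' ≠ 0 := by omega
  generalize 0 + m' = c₂ at x₂ s₂ hc
  generalize e₂ + m' = e₂ at x₂
  generalize k₂ + m' = k₂ at x₂ hk
  generalize 0 = c₃ at x₃ s₃ hc
  clear S hD I₁ I₂ hm
  obtain ⟨_, a₄, A₄, t, h⟩ := h.of_diaOut
  obtain ⟨D₄, I₄, x₁, S, hD⟩ := I₃.exists_out_pfirst x₁ s₁ t
  replace x₂ := hD _ x₂ (by simp)
  replace x₃ := hD _ x₃ (by simp)
  replace s₁ := (S a₁ (by simp [s₁])).trans (congrArg (Msg.shift 1) s₁)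
  replace s₂ := (S a₂ (by simp [s₂])).trans (congrArg (Msg.shift 1) s₂)
  replace s₃ := (S a₃ (by simp [s₃])).trans (congrArg (Msg.shift 1) s₃)
  simp only [Formula.subst, Msg.subst, Msg.lift, Msg.inst, Msg.shift] at h
  simp only [Leaf.shift, var_shift] at x₂ x₃ s₁ s₂ s₃
  obtain ⟨_, A₅, t, h⟩ := h.of_diaInp
  clear S hD I₃
  obtain ⟨D₅, N₂, I₅, x₂, S, hD⟩ := I₄.exists_inp_vwait x₂ s₂ t
  replace x₁ := hD _ x₁ (by simp)
  replace x₃ := hD _ x₃ (by simp; omega)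
  rw [← S] at s₁ s₂ s₃
  obtain ⟨_, A₆, t, h⟩ := h.of_diaInp
  clear S hD I₄
  obtain ⟨D₆, N₃, I₆, x₃, S, hD⟩ := I₅.exists_inp_vwait x₃ s₃ t
  replace x₁ := hD _ x₁ (by simp)
  replace x₂ := hD _ x₂ (by simp)
  rw [← S] at s₁ s₂ s₃
  obtain ⟨_, a₅, A₇, t, h⟩ := h.of_diaOut
  clear S hD I₅
  obtain ⟨D₇, K₂, I₇, s₅, S, hD⟩ := I₆.exists_out_vreply x₂ s₂ t
  replace x₁ := hD _ x₁ (by simp)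
  replace x₃ := hD _ x₃ (by simp; omega)
  replace s₁ := (S a₁ (by simp [s₁])).trans (congrArg (Msg.shift 2) s₁)
  replace s₃ := (S a₃ (by simp [s₃])).trans (congrArg (Msg.shift 2) s₃)
  simp only [Formula.subst, Msg.subst, Msg.lift, Msg.inst, Msg.shift] at h
  simp only [Leaf.shift, var_shift] at x₁ x₃ s₁ s₃
  obtain ⟨_, a₆, A₈, t, h⟩ := h.of_diaOut
  clear S hD I₆
  obtain ⟨D₈, K₃, I₈, s₆, S, hD⟩ := I₇.exists_out_vreply x₃ s₃ t
  replace x₁ := hD _ x₁ (by simp)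
  replace s₁ := (S a₁ (by simp [s₁])).trans (congrArg (Msg.shift 2) s₁)
  replace s₅ := (S a₅ (by simp [s₅])).trans (congrArg (Msg.shift 2) s₅)
  simp only [Formula.subst, Msg.subst, Msg.lift, Msg.inst, Msg.shift] at h
  simp only [Leaf.shift, Msg.shift, Msg.subst] at x₁ s₁ s₅
  obtain ⟨h₅, h₆⟩ := h.of_conj
  -- Both replies must carry the prover's key, which contradicts `hk`.
  have e₅ := I₈.key_eq x₁ s₁ s₅ h₅
  have e₆ := I₈.key_eq x₁ s₁ s₆ h₆
  omega

/-! ## Execution of the attack -/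

/-- The component `l` can output `N` on `M` and become `l'`, extending the scope of `m`
restrictions. -/
def Leaf.Outputs (r p : ℕ) (l : Leaf) (M : Msg) (m : ℕ) (N : Msg) (l' : Leaf) : Prop :=
  ∀ i, Trans (l.toProc r p) (.out M ([], i)) (.single ([], []))
    ⟨m, Function.update ali ([], i) N, l'.toProc (r + m) (p + m)⟩

/-- The component `l` can receive `N` on `M` and become `l'`. -/
def Leaf.Receives (r p : ℕ) (l : Leaf) (M N : Msg) (l' : Leaf) : Prop :=
  Trans (l.toProc r p) (.inp M N) (.single ([], [])) ⟨0, ali, l'.toProc r p⟩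

namespace Leaf

variable (r p c nt ke km : ℕ) (N : Msg)

theorem vstart_outputs :
    (vstart ke km).Outputs r p (var r) 1 (var 0) (vwait 0 (ke + 1) (km + 1)) :=
  fun i => .ext (.out _ _ i (.refl _))

theorem pstart_outputs :
    (pstart ke km).Outputs r p (var p) 1 (var 0) (pfirst 0 (ke + 1) (km + 1)) :=
  fun i => .ext (.out _ _ i (.refl _))

theorem pfirst_outputs :
    (pfirst c ke km).Outputs r p (var c) 1 (var 0) (pwait (c + 1) 0 (ke + 1) (km + 1)) :=
  fun i => .ext (.out _ _ i (.refl _))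

/-- The encrypted part of the reply of a verifier to the challenge `N`. -/
def _root_.BAC.replyBody (ke : ℕ) (N : Msg) : Msg :=
  enc (pair (var 1) (pair (N.shift 2) (var 0))) (var (ke + 2))

theorem vreply_outputs :
    (vreply c ke km N).Outputs r p (var c) 2
      (pair (replyBody ke N) (mac (replyBody ke N) (var (km + 2)))) done :=
  fun i => .ext (.ext (.out _ _ i (.refl _)))

theorem vwait_receives : (vwait c ke km).Receives r p (var c) N (vreply c ke km N) := by
  have := Trans.inp N (VReply (c + 1) (ke + 1) (km + 1) (var 0)) (EqE.refl (var c))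
  rwa [VReply_subst_inst] at this

theorem pwait_receives : (pwait c nt ke km).Receives r p (var c) N (pcheck c nt ke km N) := by
  have := Trans.inp N (PCheck (c + 1) (nt + 1) (ke + 1) (km + 1) (var 0)) (EqE.refl (var c))
  rwa [PCheck_subst_inst] at this

/-- The MAC matches by projection, and decryption exposes the prover's nonce in the required
position. The shape of `K` is a separate equation so that it can be checked by computation at the
point of use. -/
theorem pcheck_outputs {K A B : Msg} (hK : K = enc (pair A (pair (var nt) B)) (var ke)) :
    ∃ N', (pcheck c nt ke km (pair K (mac K (var km)))).Outputs r p (var c) 1 N' done := by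
  refine ⟨_, fun i => .mat (.mat (.ext (.out _ _ i (.refl _))) ?_) ?_⟩
  · have h : EqE (dec (fst (pair K (mac K (var km)))) (var ke)) (pair A (pair (var nt) B)) :=
      .trans (.dec (.fst_pair _ _) (.refl _)) (hK ▸ .dec_enc _ _)
    exact .symm (.trans (.fst (.trans (.snd h) (.snd_pair _ _))) (.fst_pair _ _))
  · exact .trans (.snd_pair _ _) (.mac (.symm (.fst_pair _ _)) (.refl _))

end Leaf

/-- Two verifiers `x`, `z` and a prover `y` in parallel with other processes. -/
def config (r p : ℕ) (x y z : Leaf) (W Q T : Proc) : Proc :=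
  .par (.par (.par (x.toProc r p) (y.toProc r p)) (.par (.par (z.toProc r p) W) Q)) T

section
variable {n r p m i : ℕ} {σ : Alias → Msg} {x y z l : Leaf} {W Q T : Proc} {M M' N N' : Msg}
  {φ : Formula}

theorem sat_out_x (h : x.Outputs r p M' m N l) (hM : (M.shift n).aliasSubst σ = M')
    (hd : M.fal ⊆ domSubst σ) (ha : ([false, false, false], i) ∉ domSubst σ)
    (hf : ([false, false, false], i) ∉ φ.fal)
    (H : Sat ⟨n + m, Function.update (fun a => (σ a).shift m) ([false, false, false], i) N,
      config (r + m) (p + m) l (y.shift m) (z.shift m) (W.shift m) (Q.shift m) (T.shift m)⟩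
      (φ.subst (inst (ali ([false, false, false], i))))) :
    Sat ⟨n, σ, config r p x y z W Q T⟩ (.diaOut M φ) := by
  rw [Sat]
  have t : Trans (config r p x y z W Q T) (.out M' ([], i)) _ _ := .parL (.parL (.parL (h i)))
  have e : ∀ R S : Proc, (par R S).shift m = par (R.shift m) (S.shift m) := fun _ _ => rfl
  simp only [e, Leaf.toProc_shift] at t
  exact ⟨_, _, _, .aliasOut (s := [false, false, false]) (hM ▸ t) hd ha, hf, H⟩

theorem sat_out_y (h : y.Outputs r p M' m N l) (hM : (M.shift n).aliasSubst σ = M')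
    (hd : M.fal ⊆ domSubst σ) (ha : ([false, false, true], i) ∉ domSubst σ)
    (hf : ([false, false, true], i) ∉ φ.fal)
    (H : Sat ⟨n + m, Function.update (fun a => (σ a).shift m) ([false, false, true], i) N,
      config (r + m) (p + m) (x.shift m) l (z.shift m) (W.shift m) (Q.shift m) (T.shift m)⟩
      (φ.subst (inst (ali ([false, false, true], i))))) :
    Sat ⟨n, σ, config r p x y z W Q T⟩ (.diaOut M φ) := by
  rw [Sat]
  have t : Trans (config r p x y z W Q T) (.out M' ([], i)) _ _ := .parL (.parL (.parR (h i)))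
  have e : ∀ R S : Proc, (par R S).shift m = par (R.shift m) (S.shift m) := fun _ _ => rfl
  simp only [e, Leaf.toProc_shift] at t
  exact ⟨_, _, _, .aliasOut (s := [false, false, true]) (hM ▸ t) hd ha, hf, H⟩

theorem sat_out_z (h : z.Outputs r p M' m N l) (hM : (M.shift n).aliasSubst σ = M')
    (hd : M.fal ⊆ domSubst σ) (ha : ([false, true, false, false], i) ∉ domSubst σ)
    (hf : ([false, true, false, false], i) ∉ φ.fal)
    (H : Sat ⟨n + m, Function.update (fun a => (σ a).shift m) ([false, true, false, false], i) N,
      config (r + m) (p + m) (x.shift m) (y.shift m) l (W.shift m) (Q.shift m) (T.shift m)⟩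
      (φ.subst (inst (ali ([false, true, false, false], i))))) :
    Sat ⟨n, σ, config r p x y z W Q T⟩ (.diaOut M φ) := by
  rw [Sat]
  have t : Trans (config r p x y z W Q T) (.out M' ([], i)) _ _ :=
    .parL (.parR (.parL (.parL (h i))))
  have e : ∀ R S : Proc, (par R S).shift m = par (R.shift m) (S.shift m) := fun _ _ => rfl
  simp only [e, Leaf.toProc_shift] at t
  exact ⟨_, _, _, .aliasOut (s := [false, true, false, false]) (hM ▸ t) hd ha, hf, H⟩

theorem sat_out_first (h : x.Outputs r p M' m N l) (hM : (M.shift n).aliasSubst σ = M')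
    (hd : M.fal ⊆ domSubst σ) (ha : ([false, false, false], i) ∉ domSubst σ)
    (hf : ([false, false, false], i) ∉ φ.fal)
    (H : Sat ⟨n + m, Function.update (fun a => (σ a).shift m) ([false, false, false], i) N,
      .par (.par (.par (l.toProc (r + m) (p + m)) ((y.shift m).toProc (r + m) (p + m)))
        (Q.shift m)) (T.shift m)⟩ (φ.subst (inst (ali ([false, false, false], i))))) :
    Sat ⟨n, σ, .par (.par (.par (x.toProc r p) (y.toProc r p)) Q) T⟩ (.diaOut M φ) := by
  rw [Sat]
  have t : Trans (.par (.par (.par (x.toProc r p) (y.toProc r p)) Q) T) (.out M' ([], i)) _ _ :=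
    .parL (.parL (.parL (h i)))
  simp only [Leaf.toProc_shift] at t
  exact ⟨_, _, _, .aliasOut (s := [false, false, false]) (hM ▸ t) hd ha, hf, H⟩

/-- Here the second session appears: the replication lies inside the scope already extended for `x`
and `y`, so the new copy refers to the same keys. The alias prefix is the path to `z` in the
unfolded process. -/
theorem sat_out_unfold (h : z.Outputs r p M' m N l) (hM : (M.shift n).aliasSubst σ = M')
    (hd : M.fal ⊆ domSubst σ) (ha : ([false, true, false, false], i) ∉ domSubst σ)
    (hf : ([false, true, false, false], i) ∉ φ.fal)
    (H : Sat ⟨n + m, Function.update (fun a => (σ a).shift m) ([false, true, false, false], i) N,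
      config (r + m) (p + m) (x.shift m) (y.shift m) l (W.shift m)
        ((Proc.bang (.par (z.toProc r p) W)).shift m) (T.shift m)⟩
      (φ.subst (inst (ali ([false, true, false, false], i))))) :
    Sat ⟨n, σ, .par (.par (.par (x.toProc r p) (y.toProc r p)) (.bang (.par (z.toProc r p) W))) T⟩
      (.diaOut M φ) := by
  rw [Sat]
  have t : Trans (.par (.par (.par (x.toProc r p) (y.toProc r p)) (.bang (.par (z.toProc r p) W))) T)
      (.out M' ([], i)) _ _ := .parL (.parR (.bang (.parL (.parL (h i)))))
  have e : ∀ R S : Proc, (par R S).shift m = par (R.shift m) (S.shift m) := fun _ _ => rfl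
  simp only [e, Leaf.toProc_shift] at t
  exact ⟨_, _, _, .aliasOut (s := [false, true, false, false]) (hM ▸ t) hd ha, hf, H⟩

theorem Proc.subst_var (P : Proc) : P.subst var = P := by
  have e : Msg.lift var = var := funext fun i => by cases i <;> rfl
  induction P <;> simp_all [Proc.subst, Msg.subst_var]

theorem sat_inp_of_trans {P P' : Proc} {u : LocLabel} (h : Trans P (.inp M' N') u ⟨0, ali, P'⟩)
    (hM : (M.shift n).aliasSubst σ = M') (hN : (N.shift n).aliasSubst σ = N')
    (hd : M.fal ⊆ domSubst σ) (hd' : N.fal ⊆ domSubst σ) (H : Sat ⟨n, σ, P'⟩ φ) :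
    Sat ⟨n, σ, P⟩ (.diaInp M N φ) := by
  rw [Sat]
  subst hM hN
  refine ⟨_, _, .aliasInp h hd hd', ?_⟩
  simpa [Msg.shift_zero] using H

theorem sat_inp_x (h : x.Receives r p M' N' l) (hM : (M.shift n).aliasSubst σ = M')
    (hN : (N.shift n).aliasSubst σ = N') (hd : M.fal ⊆ domSubst σ) (hd' : N.fal ⊆ domSubst σ)
    (H : Sat ⟨n, σ, config r p l y z W Q T⟩ φ) :
    Sat ⟨n, σ, config r p x y z W Q T⟩ (.diaInp M N φ) := by
  have t : Trans (config r p x y z W Q T) (.inp M' N') _ _ := .parL (.parL (.parL h))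
  simp only [Proc.shift, Nat.add_zero, Proc.subst_var] at t
  exact sat_inp_of_trans t hM hN hd hd' H

theorem sat_inp_y (h : y.Receives r p M' N' l) (hM : (M.shift n).aliasSubst σ = M')
    (hN : (N.shift n).aliasSubst σ = N') (hd : M.fal ⊆ domSubst σ) (hd' : N.fal ⊆ domSubst σ)
    (H : Sat ⟨n, σ, config r p x l z W Q T⟩ φ) :
    Sat ⟨n, σ, config r p x y z W Q T⟩ (.diaInp M N φ) := by
  have t : Trans (config r p x y z W Q T) (.inp M' N') _ _ := .parL (.parL (.parR h))
  simp only [Proc.shift, Nat.add_zero, Proc.subst_var] at t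
  exact sat_inp_of_trans t hM hN hd hd' H

theorem sat_inp_z (h : z.Receives r p M' N' l) (hM : (M.shift n).aliasSubst σ = M')
    (hN : (N.shift n).aliasSubst σ = N') (hd : M.fal ⊆ domSubst σ) (hd' : N.fal ⊆ domSubst σ)
    (H : Sat ⟨n, σ, config r p x y l W Q T⟩ φ) :
    Sat ⟨n, σ, config r p x y z W Q T⟩ (.diaInp M N φ) := by
  have t : Trans (config r p x y z W Q T) (.inp M' N') _ _ := .parL (.parR (.parL (.parL h)))
  simp only [Proc.shift, Nat.add_zero, Proc.subst_var] at t
  exact sat_inp_of_trans t hM hN hd hd' H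

end

theorem sat_top (A : ExtProc) : Sat A .top := by
  rw [Sat]; trivial

set_option linter.unusedSimpArgs false in
theorem sat_SystemCh (r p : ℕ) : Sat (ExtProc.ofProc (SystemCh r p)) (attackFormula r p) := by
  unfold attackFormula ExtProc.ofProc
  have e : ∀ (R S : Proc) m, (par R S).shift m = par (R.shift m) (S.shift m) := fun _ _ _ => rfl
  have e' : ∀ (R : Proc) m, (bang R).shift m = bang (R.shift m) := fun _ _ => rfl
  -- Unfold the outer replication, pass the restrictions of `ke` and `km`, unfold the inner
  -- replication, and let the prover announce its channel.
  have t₁ : Trans (SystemCh r p) (.out (var p) ([], 0)) _ _ :=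
    .bang (.parL (.ext (.ext (.bang (.parL (.parR
      (Leaf.pstart_outputs (r + 2) (p + 2) 1 0 0)))))))
  have hV : nu (out (var (r + 3)) (var 0) (Verifier (var 0) (var 0) (var 2) (var 1))) =
    Leaf.toProc (r + 2) (p + 2) (.vstart 1 0) := rfl
  have hP : nu (out (var (p + 3)) (var 0) (Prover (var 0) (var 0) (var 2) (var 1))) =
    Leaf.toProc (r + 2) (p + 2) (.pstart 1 0) := rfl
  simp only [Session, hV, hP, e, e', Leaf.toProc_shift] at t₁
  rw [Sat]
  refine ⟨_, _, _, .aliasOut (s := [false, false, true]) t₁ (by simp [Msg.fal])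
    (by simp [Msg.fal, domSubst, Msg.shift, Msg.subst]), by simp [Formula.fal, Msg.fal], ?_⟩
  simp only [Formula.subst, Msg.subst, Msg.lift, Msg.inst, Msg.shift]
  refine sat_out_first (i := 0) (x := .vstart 2 1) (y := .pfirst 0 2 1) (r := r + 3) (p := p + 3)
    (Leaf.vstart_outputs _ _ _ _) rfl (by simp [Msg.fal]) (by simp [Msg.fal, domSubst, Msg.shift, Msg.subst])
    (by simp [Formula.fal, Msg.fal]) ?_
  simp only [Formula.subst, Msg.subst, Msg.lift, Msg.inst, Msg.shift, e, e', Leaf.toProc_shift]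
  -- All three components have `ke` and `km` at indices 3 and 2: this sharing is the attack.
  refine sat_out_unfold (i := 0) (x := .vwait 0 3 2) (y := .pfirst 1 3 2) (z := .vstart 3 2)
    (r := r + 4) (p := p + 4)
    (Leaf.vstart_outputs _ _ _ _) rfl (by simp [Msg.fal]) (by simp [Msg.fal, domSubst, Msg.shift, Msg.subst])
    (by simp [Formula.fal, Msg.fal]) ?_
  simp only [Formula.subst, Msg.subst, Msg.lift, Msg.inst, Msg.shift]
  -- The alias variable 0 is already in use at this location, so successive outputs of a component
  -- take 0, 1, 2.
  refine sat_out_y (i := 1) (Leaf.pfirst_outputs _ _ _ _ _) rfl (by simp [Msg.fal, domSubst, Msg.shift, Msg.subst])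
    (by simp [Msg.fal, domSubst, Msg.shift, Msg.subst]) (by simp [Formula.fal, Msg.fal]) ?_
  simp only [Formula.subst, Msg.subst, Msg.lift, Msg.inst, Msg.shift]
  refine sat_inp_x (Leaf.vwait_receives _ _ _ _ _ _) rfl rfl (by simp [Msg.fal, domSubst, Msg.shift, Msg.subst])
    (by simp [Msg.fal, domSubst, Msg.shift, Msg.subst]) ?_
  refine sat_inp_z (Leaf.vwait_receives _ _ _ _ _ _) rfl rfl (by simp [Msg.fal, domSubst, Msg.shift, Msg.subst])
    (by simp [Msg.fal, domSubst, Msg.shift, Msg.subst]) ?_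
  refine sat_out_x (i := 1) (Leaf.vreply_outputs _ _ _ _ _ _) rfl (by simp [Msg.fal, domSubst, Msg.shift, Msg.subst])
    (by simp [Msg.fal, domSubst, Msg.shift, Msg.subst]) (by simp [Formula.fal, Msg.fal]) ?_
  simp only [Formula.subst, Msg.subst, Msg.lift, Msg.inst, Msg.shift]
  refine sat_out_z (i := 1) (Leaf.vreply_outputs _ _ _ _ _ _) rfl (by simp [Msg.fal, domSubst, Msg.shift, Msg.subst])
    (by simp [Msg.fal, domSubst, Msg.shift, Msg.subst]) (by simp [Formula.fal, Msg.fal]) ?_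
  simp only [Formula.subst, Msg.subst, Msg.lift, Msg.inst, Msg.shift]
  rw [Sat]
  constructor
  · refine sat_inp_y (Leaf.pwait_receives _ _ _ _ _ _ _) rfl rfl (by simp [Msg.fal, domSubst, Msg.shift, Msg.subst])
      (by simp [Msg.fal, domSubst, Msg.shift, Msg.subst]) ?_
    -- The 10 restrictions are two keys, three channels, the challenge, and two nonces for each of
    -- the two replies.
    obtain ⟨N, hN⟩ := Leaf.pcheck_outputs (r + 10) (p + 10) _ _ _ _ rfl
    exact sat_out_y (i := 2) hN rfl (by simp [Msg.fal, domSubst, Msg.shift, Msg.subst])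
      (by simp [Msg.fal, domSubst, Msg.shift, Msg.subst]) (by simp [Formula.fal, Msg.fal]) (sat_top _)
  · refine sat_inp_y (Leaf.pwait_receives _ _ _ _ _ _ _) rfl rfl (by simp [Msg.fal, domSubst, Msg.shift, Msg.subst])
      (by simp [Msg.fal, domSubst, Msg.shift, Msg.subst]) ?_
    obtain ⟨N, hN⟩ := Leaf.pcheck_outputs (r + 10) (p + 10) _ _ _ _ rfl
    exact sat_out_y (i := 2) hN rfl (by simp [Msg.fal, domSubst, Msg.shift, Msg.subst])
      (by simp [Msg.fal, domSubst, Msg.shift, Msg.subst]) (by simp [Formula.fal, Msg.fal]) (sat_top _)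

end BAC

theorem mainTheorem9 (r p : ℕ) (hrp : r ≠ p) :
    ¬ BAC.ISimulated (BAC.ExtProc.ofProc (BAC.SystemCh r p)) (BAC.ExtProc.ofProc (BAC.SpecCh r p)) ∧
    (BAC.attackFormula r p).InSimulationFragment ∧
    BAC.Sat (BAC.ExtProc.ofProc (BAC.SystemCh r p)) (BAC.attackFormula r p) ∧
    ¬ BAC.Sat (BAC.ExtProc.ofProc (BAC.SpecCh r p)) (BAC.attackFormula r p) := by
  refine ⟨?_, by simp [BAC.attackFormula, BAC.Formula.InSimulationFragment],
    BAC.sat_SystemCh r p,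
    fun h => BAC.not_posSat_SpecCh hrp (h.posSat (BAC.attackFormula_positive r p))⟩
  rintro ⟨R, hR, hAB⟩
  -- The attack formula contains no aliases, so its renaming by `id` reduces to itself.
  exact BAC.not_posSat_SpecCh hrp
    (hR.posSat hAB (BAC.sat_SystemCh r p) (BAC.attackFormula_positive r p))
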